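/- **Conventions.** Groups and groupoids act on the right; the composite of $a:x\to y$ and $b:y\to z$ is $ab:x\to z$. A crossed complex $C$ consists of a groupoid $C_1$ with object set $C_0$, families of groups $C_n(x)$ ($x\in C_0$, $n\ge 2$) with an operation of $C_1$, and boundaries $\delta_n:C_n\to C_{n-1}$ such that $\delta_2$ is a crossed module over $C_1$, the $C_n$ ($n\ge3$) are abelian, the $\delta_n$ ($n\ge3$) are operator morphisms, $\delta\delta$ is trivial, and $\delta_2C_2$ acts trivially on $C_n$ for $n\ge 3$. It is $m$-truncated if only dimensions $\le m$ are present. Write $\beta c$ for the object over which $c\in C_n$ ($n\ge2$) lies. Saying that $C_n$ is free on a family of elements means: free groupoid ($n=1$), free crossed $C_1$-module ($n=2$), free module over $C_1/\delta_2C_2$ ($n\ge3$). For $m\ge 1$, an $m$-truncated free crossed resolution of a groupoid $\Gamma$ is an $m$-truncated crossed complex $C$, free in each dimension $1,\dots,m$, with a quotient morphism $\varphi:C_1\to\Gamma$ (bijective on objects, surjective on arrows, $\varphi\delta_2$ trivial) such that $\ker\varphi=\operatorname{im}\delta_2$ if $m\ge2$ and $\ker\delta_n=\operatorname{im}\delta_{n+1}$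 for $2\le n<m$. For $\Gamma=G$ a group, $C_0$ is a point. The universal cover $p:\widetilde C\to C$ is then the pullback along $\varphi$ of the universal covering groupoid $\widetilde G\to G$ (objects $g\in G$, arrows $(g,a):g\to ga$): $\widetilde C$ has object set $G$, arrows $(g,u):g\to g\varphi(u)$ with $u\in C_1$, groups $\widetilde C_n(g)=\{g\}\times C_n$ for $n\ge2$, operation $(g,c)^{(g,u)}=(g\varphi(u),c^u)$ and boundary $\tilde\delta(g,c)=(g,\delta c)$; $p$ is $(g,c)\mapsto c$. A (partial) contracting homotopy $h$ of $\widetilde C$, $C$ being $m$-truncated, consists of functions $h_n$, $0\le n<m$: $h_0(g)$ is an arrow $g\to1$ of $\widetilde C_1$; $h_n$ maps $\widetilde C_n$ into $\widetilde C_{n+1}(1)$ for $n\ge 1$, is a morphism, and satisfies $h_n(c^{v})=h_n(c)$ for $n\ge2$; and $$\tilde\delta_{n+1}h_n(c)=\lambda_n(c)\quad(1\le n<m),$$ where $\lambda_1(c)=(h_0 a)^{-1}\,c\,(h_0 b)$ for $c:a\to b$, $\lambda_2(c)=(h_1\tilde\delta_2c)^{-1}\,c^{h_0\beta c}$ and $\lambda_n(c)=-h_{n-1}\tilde\delta_nc+c^{h_0\beta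 c}$ for $n\ge3$. Note that $\lambda_m$ is defined on $\widetilde C_m$ as soon as $h_0,\dots,h_{m-1}$ are given. **Theorem.** Let $m\ge1$, let $C$ be an $m$-truncated free crossed resolution of a group $G$ with quotient morphism $\varphi:C_1\to G$ and universal cover $p:\widetilde C\to C$. Then $p$ is a covering morphism, $\widetilde C$ is an $m$-truncated free crossed resolution of $\widetilde G$, and if $C_n$ is free on $X_n$ ($1\le n\le m$), then $\widetilde C_n$ is free on $p^{-1}(X_n)=G\times X_n$. Let $h$ be a partial contracting homotopy of $\widetilde C$, let $\widetilde C_m$ be free on $\widetilde X_m$, and let $\widetilde X_m\to X_{m+1}$, $\tilde x\mapsto x$, be a bijection. Then: 1. There is an extension of $C$ to an $(m+1)$-truncated crossed complex $e(C)$, equal to $C$ in dimensions $\le m$, with $C_{m+1}=e(C)_{m+1}$ free on $X_{m+1}$ (the free crossed $C_1$-module if $m=1$, the free $G$-module if $m\ge2$) and boundary given on generators by $$\delta_{m+1}x=p_m\bigl(\lambda_m(\tilde x)\bigr),\qquad \tilde x\in\widetilde X_m .$$ 2. For any such $e(C)$: $e(C)$ is an $(m+1)$-truncated free crossed resolution of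 $G$; its universal cover $e(\widetilde C)\to e(C)$ is a covering morphism extending $p$; and there is a unique contracting homotopy $e(h)$ of the $(m+1)$-truncated crossed complex $e(\widetilde C)$ that extends $h_0,\dots,h_{m-1}$ and satisfies $h_m(\tilde x)=(1,x)$ for $\tilde x\in\widetilde X_m$. 3. Let moreover $Y\subseteq X_{m+1}$ be such that $\delta_{m+1}Y$ generates $\ker\delta_m$ (as a $G$-module) if $m\ge2$, or generates $\ker\varphi$ as a normal subgroup of $C_1$ if $m=1$. Then there is an extension of $C$ as in 1 with $X_{m+1}$ replaced by $Y$ and $\delta_{m+1}$ by its restriction to $Y$; denote its part of dimension $m+1$ by $C_{m+1}(Y)$. Let $\xi:C_{m+1}\to C_{m+1}(Y)$ be a $G$-morphism ($m\ge2$), respectively a morphism of crossed $C_1$-modules ($m=1$), with $\xi(y)=y$ for $y\in Y$ and $\delta_{m+1}\xi(x)=\delta_{m+1}(x)$ for $x\in X_{m+1}$. Then $C$ extended by $C_{m+1}(Y)$ is an $(m+1)$-truncated free crossed resolution of $G$, its universal cover is a covering morphism, and $h_0,\dots,h_{m-1}$ together with $\tilde\xi h_m$, where $h_m$ is as in 2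 and $\tilde\xi(g,c)=(g,\xi c)$, form a contracting homotopy of its universal cover. -/

import Mathlib

open CategoryTheory

universe u

namespace FreeCrossed

/-! ### Groupoids: one-object groupoids and universal covering groupoids -/

/-- The object set of a group regarded as a groupoid with one object. -/
def OneObj (_F : Type u) : Type u := PUnit.{u + 1}

/-- The only object. -/
def OneObj.pt (F : Type u) : OneObj F := PUnit.unit

/-- A group as a one-object groupoid; the composite `u ≫ v` (first `u`, then `v`) is `u * v`. -/
instance OneObj.groupoid (F : Type u) [Group F] : Groupoid.{u} (OneObj F) where
  Hom _ _ := F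
  id _ := (1 : F)
  comp u v := HMul.hMul (α := F) (β := F) (γ := F) u v
  inv u := Inv.inv (α := F) u
  id_comp u := one_mul (M := F) u
  comp_id u := mul_one (M := F) u
  assoc u v w := mul_assoc (G := F) u v w
  inv_comp u := inv_mul_cancel (G := F) u
  comp_inv u := mul_inv_cancel (G := F) u

/-- An element of a group as an arrow of the one-object groupoid. -/
def OneObj.arr {F : Type u} [Group F] (u : F) : OneObj.pt F ⟶ OneObj.pt F := u

/-- An arrow of the one-object groupoid as an element of the group. -/
def OneObj.val {F : Type u} [Group F] {a b : OneObj F} (u : a ⟶ b) : F := u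

/-- A group morphism as a morphism of one-object groupoids. -/
def OneObj.functor {F G : Type u} [Group F] [Group G] (φ : F →* G) : OneObj F ⥤ OneObj G where
  obj _ := OneObj.pt G
  map u := OneObj.arr (φ (OneObj.val u))
  map_id _ := φ.map_one
  map_comp u v := φ.map_mul (OneObj.val u) (OneObj.val v)

/-- For a morphism `φ : F → G` of groups, the pullback along `φ` of the universal covering
groupoid of `G`: its objects are the elements of `G`, and an arrow `g ⟶ g'` is an element `u`
of `F` with `g * φ u = g'`, that is, a pair `(g, u)` with source `g` and target `g * φ u`. -/
def CovObj {F G : Type u} [Group F] [Group G] (_φ : F →* G) : Type u := G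

section Cov

variable {F G : Type u} [Group F] [Group G]

/-- An element of `G` as an object. -/
def CovObj.of (φ : F →* G) (g : G) : CovObj φ := g

/-- An object as an element of `G`. -/
def CovObj.val {φ : F →* G} (g : CovObj φ) : G := g

instance CovObj.groupoid (φ : F →* G) : Groupoid.{u} (CovObj φ) where
  Hom g g' := {u : F // g.val * φ u = g'.val}
  id g := ⟨1, by rw [map_one, mul_one]⟩
  comp u v := ⟨u.1 * v.1, by rw [map_mul, ← mul_assoc, u.2, v.2]⟩
  inv u := ⟨u.1⁻¹, by rw [map_inv]; exact mul_inv_eq_of_eq_mul u.2.symm⟩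
  id_comp u := Subtype.ext (one_mul u.1)
  comp_id u := Subtype.ext (mul_one u.1)
  assoc u v w := Subtype.ext (mul_assoc u.1 v.1 w.1)
  inv_comp u := Subtype.ext (inv_mul_cancel u.1)
  comp_inv u := Subtype.ext (mul_inv_cancel u.1)

/-- The object `1`, the base point. -/
def CovObj.base (φ : F →* G) : CovObj φ := CovObj.of φ 1

/-- The projection `(g, u) ↦ u`. -/
def CovObj.proj (φ : F →* G) : CovObj φ ⥤ OneObj F where
  obj _ := OneObj.pt F
  map u := OneObj.arr u.1
  map_id _ := rfl
  map_comp _ _ := rfl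

/-- The universal covering groupoid of `G`: objects the elements of `G`, arrows the pairs
`(g, a)` with source `g` and target `g * a`. -/
abbrev UnivCov (G : Type u) [Group G] : Type u := CovObj (MonoidHom.id G)

/-- The morphism `(g, u) ↦ (g, φ u)` to the universal covering groupoid of `G`. -/
def CovObj.toUniv (φ : F →* G) : CovObj φ ⥤ UnivCov G where
  obj g := CovObj.of (MonoidHom.id G) g.val
  map u := ⟨φ u.1, u.2⟩
  map_id _ := Subtype.ext φ.map_one
  map_comp u v := Subtype.ext (φ.map_mul u.1 v.1)

end Cov

/-! ### Crossed complexes over groupoids -/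

/-- A family of groups, one for each object of a groupoid, with a right operation of the
groupoid: `act u c` is `c ^ u`, and lies over the target of `u` if `c` lies over its source. -/
structure OpFamily (O : Type u) [Groupoid.{u} O] where
  carrier : O → Type u
  [group : ∀ x, Group (carrier x)]
  act : ∀ {x y : O}, (x ⟶ y) → carrier x →* carrier y
  act_id : ∀ (x : O) (c : carrier x), act (𝟙 x) c = c
  act_comp : ∀ {x y z : O} (u : x ⟶ y) (v : y ⟶ z) (c : carrier x),
    act (u ≫ v) c = act v (act u c)

attribute [instance] OpFamily.group

/-- `μ : M → O` is a crossed module over the groupoid `O`. -/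
structure IsCrossedModule {O : Type u} [Groupoid.{u} O] (M : OpFamily O)
    (μ : ∀ x : O, M.carrier x → (x ⟶ x)) : Prop where
  map_mul : ∀ (x : O) (c d : M.carrier x), μ x (c * d) = μ x c ≫ μ x d
  map_act : ∀ {x y : O} (u : x ⟶ y) (c : M.carrier x),
    μ y (M.act u c) = Groupoid.inv u ≫ μ x c ≫ u
  peiffer : ∀ (x : O) (c d : M.carrier x), M.act (μ x d) c = d⁻¹ * c * d

/-- A crossed complex whose groupoid in dimension 1 is `O`. The family `layer n` is the part of
dimension `n + 2`; `bd₂` is the boundary from dimension 2 to dimension 1 and `bd n` the boundary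
from dimension `n + 3` to dimension `n + 2`. All groups are written multiplicatively. -/
structure CrossedComplex (O : Type u) [Groupoid.{u} O] where
  layer : ℕ → OpFamily O
  bd₂ : ∀ x : O, (layer 0).carrier x → (x ⟶ x)
  bd : ∀ (n : ℕ) (x : O), (layer (n + 1)).carrier x →* (layer n).carrier x
  crossed : IsCrossedModule (layer 0) bd₂
  comm : ∀ (n : ℕ) (x : O) (c d : (layer (n + 1)).carrier x), c * d = d * c
  bd_act : ∀ (n : ℕ) {x y : O} (u : x ⟶ y) (c : (layer (n + 1)).carrier x),
    bd n y ((layer (n + 1)).act u c) = (layer n).act u (bd n x c)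
  bd₂_bd : ∀ (x : O) (c : (layer 1).carrier x), bd₂ x (bd 0 x c) = 𝟙 x
  bd_bd : ∀ (n : ℕ) (x : O) (c : (layer (n + 2)).carrier x), bd n x (bd (n + 1) x c) = 1
  act_bd₂ : ∀ (n : ℕ) (x : O) (d : (layer 0).carrier x) (c : (layer (n + 1)).carrier x),
    (layer (n + 1)).act (bd₂ x d) c = c

namespace CrossedComplex

variable {O : Type u} [Groupoid.{u} O]

/-- The group at `x` in dimension `n + 2`. -/
abbrev grp (C : CrossedComplex O) (n : ℕ) (x : O) : Type u := (C.layer n).carrier x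

/-- The operation of an arrow on the groups in dimension `n + 2`. -/
abbrev act (C : CrossedComplex O) (n : ℕ) {x y : O} (u : x ⟶ y) : C.grp n x →* C.grp n y :=
  (C.layer n).act u

/-- The set of all elements of dimension `n`: the objects for `n = 0`, the arrows of the groupoid
for `n = 1`, and the disjoint union of the groups of dimension `n` for `n ≥ 2`. -/
def Elt (C : CrossedComplex O) : ℕ → Type u
  | 0 => O
  | 1 => Σ a : O, Σ b : O, (a ⟶ b)
  | n + 2 => Σ x : O, C.grp n x

/-- The boundary on elements, from dimension `n + 1` to dimension `n`. (In dimension 1 there is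
a source and a target; the value given here, the target, is never used.) -/
def bdElt (C : CrossedComplex O) : ∀ n : ℕ, C.Elt (n + 1) → C.Elt n
  | 0, ⟨_, b, _⟩ => b
  | 1, ⟨x, c⟩ => ⟨x, x, C.bd₂ x c⟩
  | n + 2, ⟨x, c⟩ => ⟨x, C.bd n x c⟩

/-- An `m`-truncated crossed complex (`m ≥ 1`) has groups in dimensions up to `m` only. It is
represented by a crossed complex that is trivial in all dimensions above `m`. -/
def IsTruncated (C : CrossedComplex O) (m : ℕ) : Prop :=
  ∀ (n : ℕ) (x : O), m < n + 2 → Subsingleton (C.grp n x)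

end CrossedComplex

/-! ### Morphisms and covering morphisms -/

/-- A morphism of crossed complexes which is the functor `P` in dimensions 0 and 1. -/
structure CrsHom {O O' : Type u} [Groupoid.{u} O] [Groupoid.{u} O'] (P : O ⥤ O')
    (C : CrossedComplex O) (D : CrossedComplex O') where
  map : ∀ (n : ℕ) (x : O), C.grp n x →* D.grp n (P.obj x)
  map_act : ∀ (n : ℕ) {x y : O} (u : x ⟶ y) (c : C.grp n x),
    map n y (C.act n u c) = D.act n (P.map u) (map n x c)
  map_bd₂ : ∀ (x : O) (c : C.grp 0 x), D.bd₂ (P.obj x) (map 0 x c) = P.map (C.bd₂ x c)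
  map_bd : ∀ (n : ℕ) (x : O) (c : C.grp (n + 1) x),
    D.bd n (P.obj x) (map (n + 1) x c) = map n x (C.bd n x c)

namespace CrsHom

variable {O O' : Type u} [Groupoid.{u} O] [Groupoid.{u} O'] {P : O ⥤ O'}
  {C : CrossedComplex O} {D : CrossedComplex O'}

/-- The action of a morphism on elements of dimension `n`. -/
def elt (f : CrsHom P C D) : ∀ n : ℕ, C.Elt n → D.Elt n
  | 0, x => P.obj x
  | 1, ⟨a, b, u⟩ => ⟨P.obj a, P.obj b, P.map u⟩
  | n + 2, ⟨x, c⟩ => ⟨P.obj x, f.map n x c⟩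

/-- Covering morphisms: a covering of groupoids in dimension 1, and isomorphisms of groups in
the higher dimensions. -/
def IsCovering (f : CrsHom P C D) : Prop :=
  P.toPrefunctor.IsCovering ∧ ∀ (n : ℕ) (x : O), Function.Bijective (f.map n x)

end CrsHom

/-! ### Freeness -/

/-- The groupoid `O` is the free groupoid on the graph with the same objects and with the arrows
`arr x : s x ⟶ t x`. -/
def IsFreeGroupoidOn (O : Type u) [Groupoid.{u} O] {X : Type u} (s t : X → O)
    (arr : ∀ x, s x ⟶ t x) : Prop :=
  ∀ (H : Type u) [Groupoid.{u} H] (f₀ : O → H) (f : ∀ x, f₀ (s x) ⟶ f₀ (t x)),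
    ∃! Φ : (∀ a b : O, (a ⟶ b) → (f₀ a ⟶ f₀ b)),
      (∀ (a b c : O) (v : a ⟶ b) (w : b ⟶ c), Φ a c (v ≫ w) = Φ a b v ≫ Φ b c w) ∧
      ∀ x, Φ (s x) (t x) (arr x) = f x

/-- The crossed module `μ : M → O` is free on the elements `gen x` (at the objects `pt x`). -/
def IsFreeCrossedModuleOn {O : Type u} [Groupoid.{u} O] (M : OpFamily O)
    (μ : ∀ x : O, M.carrier x → (x ⟶ x)) {X : Type u} (pt : X → O)
    (gen : ∀ x, M.carrier (pt x)) : Prop :=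
  ∀ (N : OpFamily O) (ν : ∀ x : O, N.carrier x → (x ⟶ x)), IsCrossedModule N ν →
    ∀ f : ∀ x, N.carrier (pt x), (∀ x, ν (pt x) (f x) = μ (pt x) (gen x)) →
      ∃! Φ : (∀ y : O, M.carrier y →* N.carrier y),
        (∀ (y z : O) (v : y ⟶ z) (c : M.carrier y), Φ z (M.act v c) = N.act v (Φ y c)) ∧
        (∀ (y : O) (c : M.carrier y), ν y (Φ y c) = μ y c) ∧
        ∀ x, Φ (pt x) (gen x) = f x

/-- `M` is free on the elements `gen x` (at the objects `pt x`) among the modules over the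
fundamental groupoid of `C`, that is, among the families of abelian groups on which `O` operates
in such a way that the boundaries of the elements of dimension 2 of `C` operate trivially. -/
def IsFreeModuleOn {O : Type u} [Groupoid.{u} O] (C : CrossedComplex O) (M : OpFamily O)
    {X : Type u} (pt : X → O) (gen : ∀ x, M.carrier (pt x)) : Prop :=
  ∀ N : OpFamily O, (∀ (y : O) (c d : N.carrier y), c * d = d * c) →
    (∀ (y : O) (d : C.grp 0 y) (c : N.carrier y), N.act (C.bd₂ y d) c = c) →
    ∀ f : ∀ x, N.carrier (pt x),
      ∃! Φ : (∀ y : O, M.carrier y →* N.carrier y),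
        (∀ (y z : O) (v : y ⟶ z) (c : M.carrier y), Φ z (M.act v c) = N.act v (Φ y c)) ∧
        ∀ x, Φ (pt x) (gen x) = f x

/-- The part of dimension `n ≥ 1` of `C` is free on the family `b` of elements of dimension `n`:
as a groupoid for `n = 1`, as a crossed module for `n = 2`, and as a module over the fundamental
groupoid for `n ≥ 3`. -/
def CrossedComplex.IsFreeOn {O : Type u} [Groupoid.{u} O] (C : CrossedComplex O) {X : Type u} :
    ∀ n : ℕ, (X → C.Elt n) → Prop
  | 0, _ => True
  | 1, b => IsFreeGroupoidOn O (fun x => (b x).1) (fun x => (b x).2.1) (fun x => (b x).2.2)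
  | 2, b => IsFreeCrossedModuleOn (C.layer 0) C.bd₂ (fun x => (b x).1) (fun x => (b x).2)
  | n + 3, b => IsFreeModuleOn C (C.layer (n + 1)) (fun x => (b x).1) (fun x => (b x).2)

/-! ### Free crossed resolutions -/

/-- The functor `P` on the groupoid of dimension 1 annihilates the boundaries of dimension 2. -/
def Augments {O Γ : Type u} [Groupoid.{u} O] [Groupoid.{u} Γ] (C : CrossedComplex O)
    (P : O ⥤ Γ) : Prop :=
  ∀ (x : O) (c : C.grp 0 x), P.map (C.bd₂ x c) = 𝟙 (P.obj x)

/-- `C` is, with the quotient morphism `P : O → Γ`, an `m`-truncated free crossed resolution of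
the groupoid `Γ`: it is `m`-truncated, free in each of the dimensions `1, …, m`, and exact in
each of the dimensions below `m`. -/
structure IsFreeResolution {O Γ : Type u} [Groupoid.{u} O] [Groupoid.{u} Γ] (m : ℕ)
    (C : CrossedComplex O) (P : O ⥤ Γ) : Prop where
  truncated : C.IsTruncated m
  free : ∀ n : ℕ, 1 ≤ n → n ≤ m → ∃ (X : Type u) (b : X → C.Elt n), C.IsFreeOn n b
  obj_bijective : Function.Bijective P.obj
  map_surjective : ∀ a b : O, Function.Surjective fun v : a ⟶ b => P.map v
  augments : Augments C P
  exact₁ : 2 ≤ m → ∀ (x : O) (v : x ⟶ x), P.map v = 𝟙 (P.obj x) → ∃ c, C.bd₂ x c = v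
  exact₂ : 3 ≤ m → ∀ (x : O) (c : C.grp 0 x), C.bd₂ x c = 𝟙 x → ∃ d, C.bd 0 x d = c
  exact : ∀ n : ℕ, n + 4 ≤ m → ∀ (x : O) (c : C.grp (n + 1) x), C.bd n x c = 1 →
    ∃ d, C.bd (n + 1) x d = c

/-! ### The universal cover of a crossed complex over a group -/

section Cover

variable {F G : Type u} [Group F] [Group G]

/-- The universal cover of a crossed complex `C` with quotient morphism `φ : F → G`, that is,
the pullback of the universal covering groupoid of `G`. Its objects are the elements of `G`, its
arrows the pairs `(g, u) : g ⟶ g * φ u`, its elements of higher dimension over the object `g` the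
pairs `(g, c)`, with `(g, c) ^ (g, u) = (g * φ u, c ^ u)` and boundary `(g, c) ↦ (g, δ c)`. -/
def cover (C : CrossedComplex (OneObj F)) (φ : F →* G) (hφ : Augments C (OneObj.functor φ)) :
    CrossedComplex (CovObj φ) where
  layer n :=
    { carrier := fun _ => C.grp n (OneObj.pt F)
      act := fun v => C.act n (OneObj.arr v.1)
      act_id := fun _ c => (C.layer n).act_id (OneObj.pt F) c
      act_comp := fun v w c => (C.layer n).act_comp (OneObj.arr v.1) (OneObj.arr w.1) c }
  bd₂ g c := ⟨OneObj.val (C.bd₂ (OneObj.pt F) c), by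
    have h : φ (OneObj.val (C.bd₂ (OneObj.pt F) c)) = 1 := hφ (OneObj.pt F) c
    rw [h, mul_one]⟩
  bd n _ := C.bd n (OneObj.pt F)
  crossed :=
    { map_mul := fun _ c d => Subtype.ext (C.crossed.map_mul (OneObj.pt F) c d)
      map_act := fun v c => Subtype.ext (C.crossed.map_act (OneObj.arr v.1) c)
      peiffer := fun _ c d => C.crossed.peiffer (OneObj.pt F) c d }
  comm n _ c d := C.comm n (OneObj.pt F) c d
  bd_act n _ _ v c := C.bd_act n (OneObj.arr v.1) c
  bd₂_bd _ c := Subtype.ext (C.bd₂_bd (OneObj.pt F) c)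
  bd_bd n _ c := C.bd_bd n (OneObj.pt F) c
  act_bd₂ n _ d c := C.act_bd₂ n (OneObj.pt F) d c

/-- The projection of the universal cover, `(g, c) ↦ c`. -/
def cover.proj (C : CrossedComplex (OneObj F)) (φ : F →* G)
    (hφ : Augments C (OneObj.functor φ)) : CrsHom (CovObj.proj φ) (cover C φ hφ) C where
  map n _ := MonoidHom.id (C.grp n (OneObj.pt F))
  map_act _ _ _ _ _ := rfl
  map_bd₂ _ _ := rfl
  map_bd _ _ _ := rfl

/-- The element `(g, c)` of the universal cover. -/
def cover.lift (C : CrossedComplex (OneObj F)) (φ : F →* G)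
    (hφ : Augments C (OneObj.functor φ)) (g : G) :
    ∀ n : ℕ, C.Elt n → (cover C φ hφ).Elt n
  | 0, _ => CovObj.of φ g
  | 1, ⟨_, _, v⟩ =>
    ⟨CovObj.of φ g, CovObj.of φ (g * φ (OneObj.val v)), ⟨OneObj.val v, rfl⟩⟩
  | _ + 2, ⟨_, c⟩ => ⟨CovObj.of φ g, c⟩

/-- The morphism of universal covers induced by a morphism of crossed complexes that is the
identity in dimension 1: `(g, c) ↦ (g, f c)`. -/
def cover.map {C E : CrossedComplex (OneObj F)} (f : CrsHom (𝟭 (OneObj F)) C E) (φ : F →* G)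
    (hC : Augments C (OneObj.functor φ)) (hE : Augments E (OneObj.functor φ)) :
    CrsHom (𝟭 (CovObj φ)) (cover C φ hC) (cover E φ hE) where
  map n _ := f.map n (OneObj.pt F)
  map_act n _ _ v c := f.map_act n (OneObj.arr v.1) c
  map_bd₂ _ c := Subtype.ext (f.map_bd₂ (OneObj.pt F) c)
  map_bd n _ c := f.map_bd n (OneObj.pt F) c

end Cover

/-! ### Contracting homotopies -/

/-- The functions underlying a contracting homotopy to the object `o`: `h₀ x` is an arrow from
`x` to `o`, and `h₁` and `h n` (in dimension `n + 2`) take values in the groups at `o`. -/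
@[ext]
structure Contraction {O : Type u} [Groupoid.{u} O] (D : CrossedComplex O) (o : O) where
  h₀ : ∀ x : O, x ⟶ o
  h₁ : ∀ a b : O, (a ⟶ b) → D.grp 0 o
  h : ∀ (n : ℕ) (x : O), D.grp n x → D.grp (n + 1) o

namespace Contraction

variable {O : Type u} [Groupoid.{u} O] {D : CrossedComplex O} {o : O}

/-- The functions `h_n` on elements, from dimension `n` to dimension `n + 1`. -/
def elt (k : Contraction D o) : ∀ n : ℕ, D.Elt n → D.Elt (n + 1)
  | 0, x => ⟨x, o, k.h₀ x⟩
  | 1, ⟨a, b, v⟩ => ⟨o, k.h₁ a b v⟩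
  | n + 2, ⟨x, c⟩ => ⟨o, k.h n x c⟩

/-- The right-hand sides of the homotopy relations in dimension `n ≥ 1`:
`(h₀ (source c))⁻¹ c (h₀ (target c))` for `n = 1` and `(h_{n-1} δ c)⁻¹ c ^ (h₀ (β c))` for
`n ≥ 2`, where `β c` is the object over which `c` lies. (The value for `n = 0` is never used.) -/
def loop (k : Contraction D o) : ∀ n : ℕ, D.Elt n → D.Elt n
  | 0, _ => o
  | 1, ⟨a, b, v⟩ => ⟨o, o, Groupoid.inv (k.h₀ a) ≫ v ≫ k.h₀ b⟩
  | 2, ⟨x, c⟩ => ⟨o, (k.h₁ x x (D.bd₂ x c))⁻¹ * D.act 0 (k.h₀ x) c⟩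
  | n + 3, ⟨x, c⟩ => ⟨o, (k.h n x (D.bd n x c))⁻¹ * D.act (n + 1) (k.h₀ x) c⟩

/-- `k` is a contracting homotopy of the `m`-truncated crossed complex `D`: the functions `h_n`
with `n < m` are morphisms, annihilate the operations for `n ≥ 2`, and satisfy the homotopy
relations. (For `n ≥ m` the values of `h_n` lie in trivial groups if `D` is `m`-truncated.) -/
structure IsContracting (k : Contraction D o) (m : ℕ) : Prop where
  h₁_mul : 1 < m → ∀ (a b c : O) (v : a ⟶ b) (w : b ⟶ c),
    k.h₁ a c (v ≫ w) = k.h₁ a b v * k.h₁ b c w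
  h_mul : ∀ n : ℕ, n + 2 < m → ∀ (x : O) (c d : D.grp n x), k.h n x (c * d) = k.h n x c * k.h n x d
  h_act : ∀ n : ℕ, n + 2 < m → ∀ (x y : O) (v : x ⟶ y) (c : D.grp n x),
    k.h n y (D.act n v c) = k.h n x c
  bd₂_h₁ : 1 < m → ∀ (a b : O) (v : a ⟶ b),
    D.bd₂ o (k.h₁ a b v) = Groupoid.inv (k.h₀ a) ≫ v ≫ k.h₀ b
  bd_h₂ : 2 < m → ∀ (x : O) (c : D.grp 0 x),
    D.bd 0 o (k.h 0 x c) = (k.h₁ x x (D.bd₂ x c))⁻¹ * D.act 0 (k.h₀ x) c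
  bd_h : ∀ n : ℕ, n + 3 < m → ∀ (x : O) (c : D.grp (n + 1) x),
    D.bd (n + 1) o (k.h (n + 1) x c) = (k.h n x (D.bd n x c))⁻¹ * D.act (n + 1) (k.h₀ x) c

/-- `k` extends the functions `h_n`, `n < m`, of `h` along the morphism `f`. -/
def Extends {E : CrossedComplex O} (k : Contraction E o) (m : ℕ) (h : Contraction D o)
    (f : CrsHom (𝟭 O) D E) : Prop :=
  ∀ n : ℕ, n < m → ∀ c : D.Elt n, k.elt n (f.elt n c) = f.elt (n + 1) (h.elt n c)

end Contraction

/-! ### Extension of a truncated crossed complex by one step -/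

/-- `E`, with the morphism `α : C → E` and the family `z` of elements of dimension `m + 1`, is the
extension of the `m`-truncated crossed complex `C` to an `(m + 1)`-truncated crossed complex whose
part of dimension `m + 1` is free on `z`, with the boundaries `d i` of the generators `z i`. Here
`α` is the identity in dimension 1, and identifies `C` with the part of `E` in dimensions up
to `m`. -/
structure IsFreeExtension {O : Type u} [Groupoid.{u} O] (m : ℕ) (C E : CrossedComplex O)
    (α : CrsHom (𝟭 O) C E) {Z : Type u} (d : Z → C.Elt m) (z : Z → E.Elt (m + 1)) : Prop where
  truncated : E.IsTruncated (m + 1)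
  bijective : ∀ n : ℕ, n + 2 ≤ m → ∀ x : O, Function.Bijective (α.map n x)
  free : E.IsFreeOn (m + 1) z
  bd : ∀ i : Z, E.bdElt m (z i) = α.elt m (d i)

/-- The set `S` of elements of dimension `m ≥ 1` generates the kernel of the boundary out of
dimension `m`: for `m = 1` the kernel of `φ`, as a normal subgroup; for `m ≥ 2` the kernel of the
boundary from dimension `m` to dimension `m - 1`, as a group with operation of `F` (this kernel is
abelian and, if `C` is exact in dimension 1, it is a module over the image of `φ`). -/
def GeneratesKernel {F G : Type u} [Group F] [Group G] (C : CrossedComplex (OneObj F))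
    (φ : F →* G) : ∀ m : ℕ, Set (C.Elt m) → Prop
  | 0, _ => True
  | 1, S => Subgroup.normalClosure
      {v : F | (⟨OneObj.pt F, OneObj.pt F, OneObj.arr v⟩ : C.Elt 1) ∈ S} = φ.ker
  | 2, S => ∀ c : C.grp 0 (OneObj.pt F), C.bd₂ (OneObj.pt F) c = 𝟙 (OneObj.pt F) ↔
      ∀ K : Subgroup (C.grp 0 (OneObj.pt F)),
        (∀ (v : F) (a : C.grp 0 (OneObj.pt F)), a ∈ K → C.act 0 (OneObj.arr v) a ∈ K) →
        (∀ a : C.grp 0 (OneObj.pt F), (⟨OneObj.pt F, a⟩ : C.Elt 2) ∈ S → a ∈ K) → c ∈ K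
  | n + 3, S => ∀ c : C.grp (n + 1) (OneObj.pt F), C.bd n (OneObj.pt F) c = 1 ↔
      ∀ K : Subgroup (C.grp (n + 1) (OneObj.pt F)),
        (∀ (v : F) (a : C.grp (n + 1) (OneObj.pt F)), a ∈ K →
          C.act (n + 1) (OneObj.arr v) a ∈ K) →
        (∀ a : C.grp (n + 1) (OneObj.pt F), (⟨OneObj.pt F, a⟩ : C.Elt (n + 3)) ∈ S → a ∈ K) →
        c ∈ K

end FreeCrossed

open FreeCrossed

/-!
Everything rests on one step of induction: a contracting homotopy `h` in dimensions below `m`, on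
a crossed complex that is free in dimension `m`, is continued to dimension `m` by prescribing it on
a basis. For `m ≥ 2` the function `h_m` has to be a morphism to an abelian group annihilating the
operations. Such morphisms correspond to functions on the basis (`HasInvariantLifts`): this is the
universal property applied to a constant module, or, for a free crossed module, to the product of
the abelian group and the crossed module of loops. The right-hand side of the homotopy relation in
dimension `m` is itself an invariant morphism to the abelian group of elements of trivial boundary
at the base point (`loopFun_mul`, `loopFun_act`, `loopFun_mem_bdKer`), so the relation
holds everywhere if it holds on the basis. For `m = 1` one argues in the same way with functors
from a free groupoid to a group. This gives `Contraction.existsUnique_extension`, over an arbitrary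
groupoid; it is applied to the universal cover, once with the values `(1, x)` on the basis, and
once with the values `ξ̃ (1, x)`.

A contracting homotopy makes every loop, and every element of trivial boundary, a boundary, so
exactness of an extension is read off from its homotopy (`exists_bd₂_eq`, `exists_bd_eq`).

The universal cover inherits bases, as passing to the cover has a right adjoint, the family of
sections: morphisms from the cover to `N` are morphisms from `C` to the sections of `N`
(`sections`, `crossedSections`). In dimension 1 the corresponding object is the group `Wreath`.

Extensions exist since free modules and free crossed modules do. The boundaries of the new
generators are values of the homotopy relation, hence have trivial boundary (for `m ≥ 2`) or lie in
the kernel of `φ` (for `m = 1`).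
-/

namespace FreeCrossed

/-! ### Kernels of the boundaries -/

namespace IsCrossedModule

variable {O : Type u} [Groupoid.{u} O] {M : OpFamily O} {μ : ∀ x : O, M.carrier x → (x ⟶ x)}

theorem map_one (h : IsCrossedModule M μ) (x : O) : μ x 1 = 𝟙 x := by
  have h1 := h.map_mul x 1 1
  rw [one_mul] at h1
  have h2 : μ x 1 ≫ 𝟙 x = μ x 1 ≫ μ x 1 := by rw [← h1, Category.comp_id]
  exact ((cancel_epi (μ x 1)).1 h2).symm

theorem map_inv (h : IsCrossedModule M μ) (x : O) (c : M.carrier x) :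
    μ x c⁻¹ = Groupoid.inv (μ x c) := by
  have h1 : μ x c ≫ μ x c⁻¹ = 𝟙 x := by rw [← h.map_mul, mul_inv_cancel, h.map_one]
  rw [← cancel_epi (μ x c), h1, Groupoid.comp_inv]

/-- Elements of trivial boundary are central, by the Peiffer relation. -/
theorem comm_of_map_eq_id (h : IsCrossedModule M μ) {x : O} {c : M.carrier x} (hc : μ x c = 𝟙 x)
    (d : M.carrier x) : c * d = d * c := by
  have h1 := h.peiffer x d c
  rw [hc, M.act_id, mul_assoc, eq_inv_mul_iff_mul_eq] at h1
  exact h1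

end IsCrossedModule

namespace OpFamily

variable {O : Type u} [Groupoid.{u} O] (M : OpFamily O)

theorem act_inv_act {x y : O} (v : x ⟶ y) (c : M.carrier x) :
    M.act (Groupoid.inv v) (M.act v c) = c := by
  rw [← M.act_comp, Groupoid.comp_inv, M.act_id]

end OpFamily

namespace CrossedComplex

variable {O : Type u} [Groupoid.{u} O] (D : CrossedComplex O)

/-- The kernel of the boundary out of dimension `n + 2`, at the object `x`. -/
def bdKer : ∀ (n : ℕ) (x : O), Subgroup (D.grp n x)
  | 0, x =>
    { carrier := {c | D.bd₂ x c = 𝟙 x}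
      one_mem' := D.crossed.map_one x
      mul_mem' := fun {c d} hc hd => by
        change D.bd₂ x (c * d) = 𝟙 x
        rw [D.crossed.map_mul, Set.mem_ofPred.1 hc, Set.mem_ofPred.1 hd, Category.comp_id]
      inv_mem' := fun {c} hc => by
        change D.bd₂ x c⁻¹ = 𝟙 x
        have h1 := Groupoid.comp_inv (D.bd₂ x c)
        rw [Set.mem_ofPred.1 hc, Category.id_comp] at h1
        rw [D.crossed.map_inv, Set.mem_ofPred.1 hc, h1] }
  | n + 1, x => (D.bd n x).ker

theorem mem_bdKer_zero {x : O} {c : D.grp 0 x} : c ∈ D.bdKer 0 x ↔ D.bd₂ x c = 𝟙 x := Iff.rfl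

theorem mem_bdKer_succ {n : ℕ} {x : O} {c : D.grp (n + 1) x} :
    c ∈ D.bdKer (n + 1) x ↔ D.bd n x c = 1 := Iff.rfl

theorem bdKer_comm {n : ℕ} {x : O} {c : D.grp n x} (hc : c ∈ D.bdKer n x) (d : D.grp n x) :
    c * d = d * c := by
  cases n with
  | zero => exact D.crossed.comm_of_map_eq_id hc d
  | succ n => exact D.comm n x c d

instance (n : ℕ) (x : O) : CommGroup (D.bdKer n x) :=
  { (inferInstance : Group (D.bdKer n x)) with
    mul_comm := fun c d => Subtype.ext (D.bdKer_comm c.2 d.1) }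

theorem bd_mem_bdKer (n : ℕ) (x : O) (c : D.grp (n + 1) x) : D.bd n x c ∈ D.bdKer n x := by
  cases n with
  | zero => exact D.bd₂_bd x c
  | succ n => exact D.bd_bd n x c

theorem act_mem_bdKer {n : ℕ} {x y : O} (v : x ⟶ y) {c : D.grp n x} (hc : c ∈ D.bdKer n x) :
    D.act n v c ∈ D.bdKer n y := by
  cases n with
  | zero =>
    change D.bd₂ y _ = 𝟙 y
    rw [D.crossed.map_act, D.mem_bdKer_zero.1 hc, Category.id_comp, Groupoid.inv_comp]
  | succ n =>
    change D.bd n y _ = 1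
    rw [D.bd_act, D.mem_bdKer_succ.1 hc, _root_.map_one]

theorem act_bd₂_bdKer {n : ℕ} {x : O} (d : D.grp 0 x) {c : D.grp n x} (hc : c ∈ D.bdKer n x) :
    D.act n (D.bd₂ x d) c = c := by
  cases n with
  | zero => rw [D.crossed.peiffer, mul_assoc, D.bdKer_comm hc, inv_mul_cancel_left]
  | succ n => exact D.act_bd₂ n x d c

end CrossedComplex

/-! ### Invariant morphisms on free crossed modules and free modules -/

section Invariant

variable {O : Type u} [Groupoid.{u} O]

/-- Functions on the generators with values in any abelian group extend uniquely to morphisms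
annihilating the operations. -/
def HasInvariantLifts (M : OpFamily O) {X : Type u} (pt : X → O)
    (gen : ∀ x, M.carrier (pt x)) : Prop :=
  ∀ (A : Type u) [CommGroup A] (f : X → A), ∃! Φ : (∀ y : O, M.carrier y →* A),
    (∀ (y z : O) (v : y ⟶ z) (c : M.carrier y), Φ z (M.act v c) = Φ y c) ∧
    ∀ x, Φ (pt x) (gen x) = f x

/-- An abelian group as a constant family with trivial operation. -/
def constFamily (O : Type u) [Groupoid.{u} O] (A : Type u) [CommGroup A] : OpFamily O where
  carrier _ := A
  act _ := MonoidHom.id A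
  act_id _ _ := rfl
  act_comp _ _ _ := rfl

/-- The group of loops at `x`; the product of `v` and `w` is the composite `v ≫ w`. -/
abbrev loopGroup (x : O) : Group (x ⟶ x) where
  mul v w := v ≫ w
  one := 𝟙 x
  inv v := Groupoid.inv v
  mul_assoc := Category.assoc
  one_mul := Category.id_comp
  mul_one := Category.comp_id
  inv_mul_cancel := Groupoid.inv_comp

/-- The product of an abelian group, with trivial operation, and of the family of loops, on which
the groupoid operates by conjugation. -/
def loopFamily (O : Type u) [Groupoid.{u} O] (A : Type u) [CommGroup A] : OpFamily O where
  carrier x := A × (x ⟶ x)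
  group x := @Prod.instGroup A (x ⟶ x) _ (loopGroup x)
  act {x y} v :=
    { toFun := fun p => (p.1, Groupoid.inv v ≫ p.2 ≫ v)
      map_one' := Prod.ext rfl (by
        change Groupoid.inv v ≫ 𝟙 x ≫ v = 𝟙 y
        rw [Category.id_comp, Groupoid.inv_comp])
      map_mul' := fun p q => Prod.ext rfl (by
        change Groupoid.inv v ≫ (p.2 ≫ q.2) ≫ v =
          (Groupoid.inv v ≫ p.2 ≫ v) ≫ (Groupoid.inv v ≫ q.2 ≫ v)
        simp) }
  act_id x p := Prod.ext rfl (by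
    change Groupoid.inv (𝟙 x) ≫ p.2 ≫ 𝟙 x = p.2
    simp)
  act_comp v w p := Prod.ext rfl (by
    change Groupoid.inv (v ≫ w) ≫ p.2 ≫ v ≫ w =
      Groupoid.inv w ≫ (Groupoid.inv v ≫ p.2 ≫ v) ≫ w
    simp)

theorem isCrossedModule_loopFamily (A : Type u) [CommGroup A] :
    IsCrossedModule (loopFamily O A) (fun _ p => p.2) where
  map_mul _ _ _ := rfl
  map_act _ _ := rfl
  peiffer _ p q := Prod.ext (by
    change p.1 = q.1⁻¹ * p.1 * q.1
    rw [mul_comm, mul_inv_cancel_left]) (by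
    change Groupoid.inv q.2 ≫ p.2 ≫ q.2 = (Groupoid.inv q.2 ≫ p.2) ≫ q.2
    rw [Category.assoc])

/-- A morphism to an abelian group annihilating the operations is the same as a morphism to the
crossed module `loopFamily`. -/
theorem IsFreeCrossedModuleOn.hasInvariantLifts {M : OpFamily O}
    {μ : ∀ x : O, M.carrier x → (x ⟶ x)} (hμ : IsCrossedModule M μ) {X : Type u} {pt : X → O}
    {gen : ∀ x, M.carrier (pt x)} (h : IsFreeCrossedModuleOn M μ pt gen) :
    HasInvariantLifts M pt gen := by
  intro A _ f
  obtain ⟨Φ, ⟨hΦ₁, hΦ₂, hΦ₃⟩, hΦ⟩ := h (loopFamily O A) (fun _ p => p.2)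
    (isCrossedModule_loopFamily A) (fun x => (f x, μ _ (gen x))) (fun _ => rfl)
  refine ⟨fun y =>
    { toFun := fun c => (Φ y c).1
      map_one' := congrArg Prod.fst ((Φ y).map_one)
      map_mul' := fun c d => congrArg Prod.fst ((Φ y).map_mul c d) }, ⟨fun y z v c => ?_,
      fun x => ?_⟩, ?_⟩
  · exact congrArg Prod.fst (hΦ₁ y z v c)
  · exact congrArg Prod.fst (hΦ₃ x)
  · rintro Ψ ⟨hΨ₁, hΨ₂⟩
    have key := hΦ (fun y =>
      { toFun := fun c => ((Ψ y c, μ y c) : A × (y ⟶ y))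
        map_one' := Prod.ext (_root_.map_one _) (hμ.map_one y)
        map_mul' := fun c d => Prod.ext (_root_.map_mul _ c d) (hμ.map_mul y c d) })
      ⟨fun y z v c => Prod.ext (hΨ₁ y z v c) (hμ.map_act v c), fun _ _ => rfl,
        fun x => Prod.ext (hΨ₂ x) rfl⟩
    funext y
    ext c
    exact congrArg Prod.fst (DFunLike.congr_fun (congrFun key y) c)

theorem IsFreeModuleOn.hasInvariantLifts {C : CrossedComplex O} {M : OpFamily O} {X : Type u}
    {pt : X → O} {gen : ∀ x, M.carrier (pt x)} (h : IsFreeModuleOn C M pt gen) :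
    HasInvariantLifts M pt gen := by
  intro A _ f
  exact h (constFamily O A) (fun _ c d => mul_comm (G := A) c d) (fun _ _ _ => rfl) f

theorem CrossedComplex.IsFreeOn.hasInvariantLifts {D : CrossedComplex O} {X : Type u} {n : ℕ}
    {b : X → D.Elt (n + 2)} (h : D.IsFreeOn (n + 2) b) :
    HasInvariantLifts (D.layer n) (fun i => (b i).1) (fun i => (b i).2) := by
  cases n with
  | zero => exact IsFreeCrossedModuleOn.hasInvariantLifts D.crossed h
  | succ n => exact IsFreeModuleOn.hasInvariantLifts h

/-- Invariant morphisms to a commutative group that agree on the generators are equal. -/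
theorem HasInvariantLifts.ext {M : OpFamily O} {X : Type u} {pt : X → O}
    {gen : ∀ x, M.carrier (pt x)} (h : HasInvariantLifts M pt gen) {A : Type u} [Group A]
    (hA : ∀ a b : A, a * b = b * a) {Φ Ψ : ∀ y : O, M.carrier y →* A}
    (hΦ : ∀ (y z : O) (v : y ⟶ z) (c : M.carrier y), Φ z (M.act v c) = Φ y c)
    (hΨ : ∀ (y z : O) (v : y ⟶ z) (c : M.carrier y), Ψ z (M.act v c) = Ψ y c)
    (hg : ∀ x, Φ (pt x) (gen x) = Ψ (pt x) (gen x)) : Φ = Ψ := by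
  let _ : CommGroup A := { (inferInstance : Group A) with mul_comm := hA }
  exact (h A fun x => Ψ (pt x) (gen x)).unique ⟨hΦ, hg⟩ ⟨hΨ, fun _ => rfl⟩

end Invariant

/-! ### Extension of a contracting homotopy by one dimension -/

section Extension

variable {O : Type u} [Groupoid.{u} O]

/-- A free groupoid has the universal property of its generators for morphisms to groups. -/
theorem IsFreeGroupoidOn.existsUnique_toGroup {X : Type u} {s t : X → O} {arr : ∀ x, s x ⟶ t x}
    (h : IsFreeGroupoidOn O s t arr) (A : Type u) [Group A] (f : X → A) :
    ∃! Φ : (∀ a b : O, (a ⟶ b) → A),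
      (∀ (a b c : O) (v : a ⟶ b) (w : b ⟶ c), Φ a c (v ≫ w) = Φ a b v * Φ b c w) ∧
      ∀ x, Φ (s x) (t x) (arr x) = f x :=
  h (OneObj A) (fun _ => OneObj.pt A) f

namespace Contraction

variable {D : CrossedComplex O} {o : O}

/-- The right-hand side of the homotopy relation in dimension `n + 2`, as a function between the
groups at `x` and at `o`. -/
def loopFun (k : Contraction D o) : ∀ (n : ℕ) (x : O), D.grp n x → D.grp n o
  | 0, x, c => (k.h₁ x x (D.bd₂ x c))⁻¹ * D.act 0 (k.h₀ x) c
  | n + 1, x, c => (k.h n x (D.bd n x c))⁻¹ * D.act (n + 1) (k.h₀ x) c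

theorem loop_eq_loopFun (k : Contraction D o) (n : ℕ) (c : D.Elt (n + 2)) :
    k.loop (n + 2) c = (⟨o, k.loopFun n c.1 c.2⟩ : Σ x : O, D.grp n x) := by
  cases n <;> rfl

/-- `h_{n+2}` is a morphism, annihilates the operations, and satisfies the homotopy relation. -/
structure IsContractingAt (k : Contraction D o) (n : ℕ) : Prop where
  mul : ∀ (x : O) (c d : D.grp n x), k.h n x (c * d) = k.h n x c * k.h n x d
  act : ∀ (x y : O) (v : x ⟶ y) (c : D.grp n x), k.h n y (D.act n v c) = k.h n x c
  bd : ∀ (x : O) (c : D.grp n x), D.bd n o (k.h n x c) = k.loopFun n x c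

theorem IsContracting.at {k : Contraction D o} {m : ℕ} (hk : k.IsContracting m) {n : ℕ}
    (hn : n + 2 < m) : k.IsContractingAt n where
  mul := hk.h_mul n hn
  act := hk.h_act n hn
  bd := by
    cases n with
    | zero => exact hk.bd_h₂ hn
    | succ n => exact hk.bd_h n hn

theorem IsContracting.of_at {k : Contraction D o} {m : ℕ}
    (h₁_mul : 1 < m → ∀ (a b c : O) (v : a ⟶ b) (w : b ⟶ c),
      k.h₁ a c (v ≫ w) = k.h₁ a b v * k.h₁ b c w)
    (bd₂_h₁ : 1 < m → ∀ (a b : O) (v : a ⟶ b),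
      D.bd₂ o (k.h₁ a b v) = Groupoid.inv (k.h₀ a) ≫ v ≫ k.h₀ b)
    (hat : ∀ n, n + 2 < m → k.IsContractingAt n) : k.IsContracting m where
  h₁_mul := h₁_mul
  h_mul n hn := (hat n hn).mul
  h_act n hn := (hat n hn).act
  bd₂_h₁ := bd₂_h₁
  bd_h₂ hn := (hat 0 hn).bd
  bd_h n hn := (hat (n + 1) hn).bd

section

variable {k : Contraction D o} {m : ℕ} (hk : k.IsContracting m)
include hk

theorem IsContracting.h₁_id (hm : 1 < m) (x : O) : k.h₁ x x (𝟙 x) = 1 := by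
  have h := hk.h₁_mul hm x x x (𝟙 x) (𝟙 x)
  rw [Category.comp_id] at h
  exact left_eq_mul.1 h

theorem IsContracting.h₁_inv (hm : 1 < m) {x y : O} (v : x ⟶ y) :
    k.h₁ y x (Groupoid.inv v) = (k.h₁ x y v)⁻¹ := by
  rw [eq_inv_iff_mul_eq_one, ← hk.h₁_mul hm, Groupoid.inv_comp, hk.h₁_id hm]

theorem IsContracting.h_one {n : ℕ} (hn : n + 2 < m) (x : O) : k.h n x 1 = 1 := by
  have h := hk.h_mul n hn x 1 1
  rw [mul_one] at h
  exact left_eq_mul.1 h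

theorem IsContracting.loopFun_of_mem_bdKer {n : ℕ} (hn : n + 2 ≤ m) {x : O} {c : D.grp n x}
    (hc : c ∈ D.bdKer n x) : k.loopFun n x c = D.act n (k.h₀ x) c := by
  cases n with
  | zero =>
    change (k.h₁ x x (D.bd₂ x c))⁻¹ * _ = _
    rw [D.mem_bdKer_zero.1 hc, hk.h₁_id (by lia), inv_one, one_mul]
  | succ n =>
    change (k.h n x (D.bd n x c))⁻¹ * _ = _
    rw [D.mem_bdKer_succ.1 hc, hk.h_one (by lia), inv_one, one_mul]

theorem IsContracting.loopFun_mem_bdKer {n : ℕ} (hn : n + 2 ≤ m) (x : O) (c : D.grp n x) :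
    k.loopFun n x c ∈ D.bdKer n o := by
  cases n with
  | zero =>
    change D.bd₂ o ((k.h₁ x x (D.bd₂ x c))⁻¹ * D.act 0 (k.h₀ x) c) = 𝟙 o
    rw [D.crossed.map_mul, D.crossed.map_inv, hk.bd₂_h₁ (by lia), D.crossed.map_act,
      Groupoid.inv_comp]
  | succ n =>
    change D.bd n o ((k.h n x (D.bd n x c))⁻¹ * D.act (n + 1) (k.h₀ x) c) = 1
    rw [map_mul, map_inv, (hk.at (n := n) (by lia)).bd, D.bd_act,
      hk.loopFun_of_mem_bdKer (by lia) (D.bd_mem_bdKer n x c), inv_mul_cancel]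

theorem IsContracting.loopFun_mul {n : ℕ} (hn : n + 2 ≤ m) (x : O) (c d : D.grp n x) :
    k.loopFun n x (c * d) = k.loopFun n x c * k.loopFun n x d := by
  cases n with
  | zero =>
    -- The value at `c` is central, as it has trivial boundary.
    have hz := D.bdKer_comm (hk.loopFun_mem_bdKer hn x c)
    change (k.h₁ x x (D.bd₂ x (c * d)))⁻¹ * D.act 0 (k.h₀ x) (c * d) =
      _ * ((k.h₁ x x (D.bd₂ x d))⁻¹ * D.act 0 (k.h₀ x) d)
    rw [← mul_assoc, hz, mul_assoc, D.crossed.map_mul, hk.h₁_mul (by lia), map_mul, mul_inv_rev]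
    simp only [mul_assoc, loopFun]
  | succ n =>
    change (k.h n x (D.bd n x (c * d)))⁻¹ * D.act (n + 1) (k.h₀ x) (c * d) =
      ((k.h n x (D.bd n x c))⁻¹ * D.act (n + 1) (k.h₀ x) c) *
        ((k.h n x (D.bd n x d))⁻¹ * D.act (n + 1) (k.h₀ x) d)
    rw [map_mul, hk.h_mul n (by lia), map_mul, mul_inv_rev, D.comm n o (_)⁻¹ (_)⁻¹, mul_assoc,
      mul_assoc, ← mul_assoc (_)⁻¹ _ (D.act (n + 1) (k.h₀ x) d), D.comm n o (_)⁻¹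
        (D.act (n + 1) (k.h₀ x) c), mul_assoc]

/-- Transport along `v` and then to `o` differs from transport to `o` by the operation of the
boundary of `h₁ v`. -/
theorem IsContracting.act_h₀_act (hm : 1 < m) (n : ℕ) {x y : O} (v : x ⟶ y) (c : D.grp n x) :
    D.act n (k.h₀ y) (D.act n v c) =
      D.act n (D.bd₂ o (k.h₁ x y v)) (D.act n (k.h₀ x) c) := by
  rw [hk.bd₂_h₁ hm, ← (D.layer n).act_comp, ← (D.layer n).act_comp, ← Category.assoc,
    Groupoid.comp_inv, Category.id_comp]

theorem IsContracting.loopFun_act {n : ℕ} (hn : n + 2 ≤ m) {x y : O} (v : x ⟶ y)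
    (c : D.grp n x) : k.loopFun n y (D.act n v c) = k.loopFun n x c := by
  cases n with
  | zero =>
    have hz := D.bdKer_comm (hk.loopFun_mem_bdKer hn x c)
    change (k.h₁ y y (D.bd₂ y (D.act 0 v c)))⁻¹ * D.act 0 (k.h₀ y) (D.act 0 v c) = _
    rw [hk.act_h₀_act (by lia), D.crossed.peiffer, D.crossed.map_act, hk.h₁_mul (by lia),
      hk.h₁_mul (by lia), hk.h₁_inv (by lia)]
    trans (k.h₁ x y v)⁻¹ * (k.loopFun 0 x c * k.h₁ x y v)
    · simp only [mul_assoc, mul_inv_rev, inv_inv, loopFun, mul_inv_cancel_left]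
    · rw [hz, inv_mul_cancel_left]
  | succ n =>
    change (k.h n y (D.bd n y (D.act (n + 1) v c)))⁻¹ *
      D.act (n + 1) (k.h₀ y) (D.act (n + 1) v c) = _
    rw [hk.act_h₀_act (by lia), D.act_bd₂, D.bd_act, hk.h_act n (by lia)]
    rfl

/-- A contracting homotopy exhibits every loop as a boundary. -/
theorem IsContracting.exists_bd₂_eq (hm : 1 < m) (x : O) (v : x ⟶ x) : ∃ c, D.bd₂ x c = v := by
  refine ⟨D.act 0 (Groupoid.inv (k.h₀ x)) (k.h₁ x x v), ?_⟩
  rw [D.crossed.map_act, hk.bd₂_h₁ hm]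
  simp

/-- A contracting homotopy exhibits every element of trivial boundary as a boundary. -/
theorem IsContracting.exists_bd_eq {n : ℕ} (hn : n + 2 < m) {x : O} {c : D.grp n x}
    (hc : c ∈ D.bdKer n x) : ∃ d, D.bd n x d = c := by
  refine ⟨D.act (n + 1) (Groupoid.inv (k.h₀ x)) (k.h n x c), ?_⟩
  rw [D.bd_act, (hk.at hn).bd, hk.loopFun_of_mem_bdKer hn.le hc]
  exact (D.layer n).act_inv_act _ _

end

/-- Extension of a contracting homotopy from dimensions below `1` to dimensions below `2`. -/
theorem existsUnique_extension_one (k₀ : Contraction D o) (hD : D.IsTruncated 2) {X : Type u}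
    {xt : X → D.Elt 1} (hxt : D.IsFreeOn 1 xt) (y : X → D.Elt 2)
    (hy : ∀ i, D.bdElt 1 (y i) = k₀.loop 1 (xt i)) :
    ∃! k : Contraction D o, k.IsContracting 2 ∧
      (∀ n, n < 1 → ∀ c : D.Elt n, k.elt n c = k₀.elt n c) ∧ ∀ i, k.elt 1 (xt i) = y i := by
  have hfree : IsFreeGroupoidOn O (fun i => (xt i).1) (fun i => (xt i).2.1)
    (fun i => (xt i).2.2) := hxt
  have hy' : ∀ i, ∃ c : D.grp 0 o, y i = (⟨o, c⟩ : Σ x : O, D.grp 0 x) ∧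
      D.bd₂ o c = Groupoid.inv (k₀.h₀ (xt i).1) ≫ (xt i).2.2 ≫ k₀.h₀ (xt i).2.1 := by
    intro i
    have h := hy i
    generalize y i = e at h ⊢
    obtain ⟨x, c⟩ := e
    have h' : (⟨x, x, D.bd₂ x c⟩ : Σ a : O, Σ b : O, (a ⟶ b)) =
      ⟨o, o, Groupoid.inv (k₀.h₀ (xt i).1) ≫ (xt i).2.2 ≫ k₀.h₀ (xt i).2.1⟩ := h
    obtain rfl : x = o := congrArg Sigma.fst h'
    exact ⟨c, rfl, eq_of_heq (Sigma.mk.inj (eq_of_heq (Sigma.mk.inj h').2)).2⟩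
  choose w hw hbw using hy'
  obtain ⟨Φ, ⟨hΦ₁, hΦ₂⟩, hΦ⟩ := hfree.existsUnique_toGroup (D.grp 0 o) w
  have hsub (n : ℕ) (x : O) : Subsingleton (D.grp (n + 1) x) := hD (n + 1) x (by lia)
  refine ⟨⟨k₀.h₀, Φ, fun _ _ _ => 1⟩, ⟨IsContracting.of_at (fun _ => hΦ₁) (fun _ => ?_)
    (fun n hn => by lia), fun n hn => ?_, fun i => ?_⟩, ?_⟩
  · -- Both sides are morphisms to the group of loops at `o`.
    let _ := loopGroup o
    have key := (hfree.existsUnique_toGroup (o ⟶ o)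
        (fun i => Groupoid.inv (k₀.h₀ (xt i).1) ≫ (xt i).2.2 ≫ k₀.h₀ (xt i).2.1)).unique
      (y₁ := fun a b v => D.bd₂ o (Φ a b v))
      (y₂ := fun a b v => Groupoid.inv (k₀.h₀ a) ≫ v ≫ k₀.h₀ b)
      ⟨fun a b c v w => by
        rw [hΦ₁, D.crossed.map_mul]; rfl, fun i => by rw [hΦ₂, hbw]⟩
      ⟨fun a b c v w => by
        change _ = (Groupoid.inv (k₀.h₀ a) ≫ v ≫ k₀.h₀ b) ≫
          (Groupoid.inv (k₀.h₀ b) ≫ w ≫ k₀.h₀ c)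
        simp, fun i => rfl⟩
    exact fun a b v => congrFun (congrFun (congrFun key a) b) v
  · obtain rfl : n = 0 := by lia
    exact fun _ => rfl
  · rw [hw i, ← hΦ₂ i]
    rfl
  · rintro k ⟨hk₁, hk₂, hk₃⟩
    ext1
    · funext x
      have h : (⟨x, o, k.h₀ x⟩ : Σ a : O, Σ b : O, (a ⟶ b)) = ⟨x, o, k₀.h₀ x⟩ :=
        hk₂ 0 one_pos x
      exact eq_of_heq (Sigma.mk.inj (eq_of_heq (Sigma.mk.inj h).2)).2
    · refine hΦ _ ⟨hk₁.h₁_mul (by lia), fun i => ?_⟩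
      have h : (⟨o, k.h₁ _ _ (xt i).2.2⟩ : Σ x : O, D.grp 0 x) = ⟨o, w i⟩ :=
        (hk₃ i).trans (hw i)
      exact eq_of_heq (Sigma.mk.inj h).2
    · funext n x c
      exact Subsingleton.elim _ _

/-- Extension of a contracting homotopy from dimensions below `n + 2` to dimensions below
`n + 3`. The homotopy relation in dimension `n + 2` holds as both of its sides are invariant
morphisms to the abelian group of elements of trivial boundary at `o`. -/
theorem existsUnique_extension_succ {n : ℕ} {k₀ : Contraction D o} (hk₀ : k₀.IsContracting (n + 2))
    (hD : D.IsTruncated (n + 3)) {X : Type u} {xt : X → D.Elt (n + 2)}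
    (hxt : D.IsFreeOn (n + 2) xt) (y : X → D.Elt (n + 3))
    (hy : ∀ i, D.bdElt (n + 2) (y i) = k₀.loop (n + 2) (xt i)) :
    ∃! k : Contraction D o, k.IsContracting (n + 3) ∧
      (∀ j, j < n + 2 → ∀ c : D.Elt j, k.elt j c = k₀.elt j c) ∧
      ∀ i, k.elt (n + 2) (xt i) = y i := by
  have hlift := hxt.hasInvariantLifts
  have hy' : ∀ i, ∃ c : D.grp (n + 1) o, y i = (⟨o, c⟩ : Σ x : O, D.grp (n + 1) x) ∧
      D.bd n o c = k₀.loopFun n (xt i).1 (xt i).2 := by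
    intro i
    have h := (hy i).trans (k₀.loop_eq_loopFun n (xt i))
    generalize y i = e at h ⊢
    obtain ⟨x, c⟩ := e
    have h' : (⟨x, D.bd n x c⟩ : Σ x : O, D.grp n x) =
      ⟨o, k₀.loopFun n (xt i).1 (xt i).2⟩ := h
    obtain rfl : x = o := congrArg Sigma.fst h'
    exact ⟨c, rfl, eq_of_heq (Sigma.mk.inj h').2⟩
  choose w hw hbw using hy'
  let _ : CommGroup (D.grp (n + 1) o) :=
    { (inferInstance : Group (D.grp (n + 1) o)) with mul_comm := D.comm n o }
  obtain ⟨Φ, ⟨hΦ₁, hΦ₂⟩, hΦ⟩ := hlift (D.grp (n + 1) o) w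
  let Φ' : ∀ x : O, D.grp n x → D.grp (n + 1) o := fun x c => Φ x c
  -- Values of `k₀` above dimension `n + 2` lie in trivial groups and can be kept.
  let k : Contraction D o := ⟨k₀.h₀, k₀.h₁, Function.update k₀.h n Φ'⟩
  have hkn : k.h n = Φ' := Function.update_self _ _ _
  have hkj : ∀ j, j ≠ n → k.h j = k₀.h j := fun j hj => Function.update_of_ne hj _ _
  have hloop : ∀ j, j ≤ n → k.loopFun j = k₀.loopFun j := by
    intro j hj
    cases j with
    | zero => rfl
    | succ j =>
      funext x c
      change (k.h j x _)⁻¹ * _ = (k₀.h j x _)⁻¹ * _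
      rw [hkj j (by lia)]
  have hsub (j : ℕ) (hj : n < j) (x : O) : Subsingleton (D.grp (j + 1) x) :=
    hD (j + 1) x (by lia)
  -- The right-hand side of the homotopy relation as a family of morphisms.
  let Λ : ∀ x : O, D.grp n x →* D.bdKer n o := fun x =>
    { toFun := fun c => ⟨k₀.loopFun n x c, hk₀.loopFun_mem_bdKer le_rfl x c⟩
      map_one' := Subtype.ext (by
        have h := hk₀.loopFun_mul le_rfl x 1 1
        rw [mul_one] at h
        exact left_eq_mul.1 h)
      map_mul' := fun c d => Subtype.ext (hk₀.loopFun_mul le_rfl x c d) }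
  let B : ∀ x : O, D.grp n x →* D.bdKer n o := fun x =>
    { toFun := fun c => ⟨D.bd n o (Φ x c), D.bd_mem_bdKer n o _⟩
      map_one' := Subtype.ext (by
        change D.bd n o (Φ x 1) = 1
        rw [map_one, map_one])
      map_mul' := fun c d => Subtype.ext (by
        change D.bd n o (Φ x (c * d)) = D.bd n o (Φ x c) * D.bd n o (Φ x d)
        rw [map_mul, map_mul]) }
  have hBΛ : B = Λ := by
    refine hlift.ext mul_comm (fun y z v c => Subtype.ext ?_) (fun y z v c => Subtype.ext ?_)
      (fun i => Subtype.ext ?_)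
    · exact congrArg (D.bd n o) (hΦ₁ y z v c)
    · exact hk₀.loopFun_act le_rfl v c
    · change D.bd n o (Φ _ _) = _
      rw [hΦ₂, hbw]
      rfl
  refine ⟨k, ⟨IsContracting.of_at (fun _ => hk₀.h₁_mul (by lia)) (fun _ => hk₀.bd₂_h₁ (by lia))
    (fun j hj => ?_), fun j hj => ?_, fun i => ?_⟩, ?_⟩
  · rcases (show j ≤ n by lia).lt_or_eq with hjn | rfl
    · have hat := hk₀.at (n := j) (by lia)
      refine ⟨?_, ?_, ?_⟩
      · rw [hkj j (by lia)]
        exact hat.mul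
      · rw [hkj j (by lia)]
        exact hat.act
      · rw [hkj j (by lia), hloop j (by lia)]
        exact hat.bd
    · refine ⟨?_, ?_, ?_⟩
      · rw [hkn]
        exact fun x c d => map_mul (Φ x) c d
      · rw [hkn]
        exact hΦ₁
      · rw [hkn, hloop j le_rfl]
        exact fun x c => congrArg Subtype.val (DFunLike.congr_fun (congrFun hBΛ x) c)
  · match j, hj with
    | 0, _ => exact fun _ => rfl
    | 1, _ => exact fun _ => rfl
    | j + 2, hj =>
      intro c
      change (⟨o, k.h j c.1 c.2⟩ : Σ x : O, D.grp (j + 1) x) = ⟨o, k₀.h j c.1 c.2⟩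
      rw [hkj j (by lia)]
  · rw [hw i, ← hΦ₂ i]
    change (⟨o, k.h n (xt i).1 (xt i).2⟩ : Σ x : O, D.grp (n + 1) x) = _
    rw [hkn]
  · rintro k' ⟨hk₁, hk₂, hk₃⟩
    ext1
    · funext x
      have h : (⟨x, o, k'.h₀ x⟩ : Σ a : O, Σ b : O, (a ⟶ b)) = ⟨x, o, k₀.h₀ x⟩ :=
        hk₂ 0 (by lia) x
      exact eq_of_heq (Sigma.mk.inj (eq_of_heq (Sigma.mk.inj h).2)).2
    · funext a b v
      have h : (⟨o, k'.h₁ a b v⟩ : Σ x : O, D.grp 0 x) = ⟨o, k₀.h₁ a b v⟩ :=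
        hk₂ 1 (by lia) ⟨a, b, v⟩
      exact eq_of_heq (Sigma.mk.inj h).2
    · funext j x c
      rcases lt_trichotomy j n with hj | rfl | hj
      · have h : (⟨o, k'.h j x c⟩ : Σ x : O, D.grp (j + 1) x) = ⟨o, k₀.h j x c⟩ :=
          hk₂ (j + 2) (by lia) ⟨x, c⟩
        rw [hkj j (by lia)]
        exact eq_of_heq (Sigma.mk.inj h).2
      · have hat := hk₁.at (n := j) (by lia)
        have key := hΦ (fun x => MonoidHom.mk' (k'.h j x) (hat.mul x)) ⟨hat.act, fun i => by
          have h : (⟨o, k'.h j (xt i).1 (xt i).2⟩ : Σ x : O, D.grp (j + 1) x) = ⟨o, w i⟩ :=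
            (hk₃ i).trans (hw i)
          exact eq_of_heq (Sigma.mk.inj h).2⟩
        rw [hkn]
        exact DFunLike.congr_fun (congrFun key x) c
      · have := hsub j hj o
        exact Subsingleton.elim _ _

/-- A contracting homotopy of the part of `D` in dimensions up to `m`, where `D` is free in
dimension `m` and `(m + 1)`-truncated, extends uniquely to a contracting homotopy of `D` with
given values on the generators, provided that these satisfy the homotopy relation. -/
theorem existsUnique_extension {m : ℕ} (hm : 1 ≤ m) {k₀ : Contraction D o}
    (hk₀ : k₀.IsContracting m) (hD : D.IsTruncated (m + 1)) {X : Type u} {xt : X → D.Elt m}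
    (hxt : D.IsFreeOn m xt) (y : X → D.Elt (m + 1))
    (hy : ∀ i, D.bdElt m (y i) = k₀.loop m (xt i)) :
    ∃! k : Contraction D o, k.IsContracting (m + 1) ∧
      (∀ n, n < m → ∀ c : D.Elt n, k.elt n c = k₀.elt n c) ∧ ∀ i, k.elt m (xt i) = y i := by
  match m, hm with
  | 1, _ => exact existsUnique_extension_one k₀ hD hxt y hy
  | n + 2, _ => exact existsUnique_extension_succ hk₀ hD hxt y hy

end Contraction

end Extension

/-! ### Transfer along morphisms that are isomorphisms in low dimensions -/

section Transfer

variable {O : Type u} [Groupoid.{u} O] {D E : CrossedComplex O} {β : CrsHom (𝟭 O) D E} {m : ℕ}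

theorem CrsHom.map_act_id (β : CrsHom (𝟭 O) D E) (n : ℕ) {x y : O} (v : x ⟶ y)
    (c : D.grp n x) : β.map n y (D.act n v c) = E.act n v (β.map n x c) := β.map_act n v c

theorem CrsHom.map_bd₂_id (β : CrsHom (𝟭 O) D E) {x : O} (c : D.grp 0 x) :
    E.bd₂ x (β.map 0 x c) = D.bd₂ x c := β.map_bd₂ x c

theorem CrsHom.map_bd_id (β : CrsHom (𝟭 O) D E) (n : ℕ) {x : O} (c : D.grp (n + 1) x) :
    E.bd n x (β.map (n + 1) x c) = β.map n x (D.bd n x c) := β.map_bd n x c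

theorem CrsHom.elt_bdElt (β : CrsHom (𝟭 O) D E) (hm : 1 ≤ m) (c : D.Elt (m + 1)) :
    E.bdElt m (β.elt (m + 1) c) = β.elt m (D.bdElt m c) := by
  match m, hm with
  | 1, _ =>
    obtain ⟨x, c⟩ := c
    change (⟨x, x, E.bd₂ x (β.map 0 x c)⟩ : Σ a : O, Σ b : O, (a ⟶ b)) = ⟨x, x, D.bd₂ x c⟩
    rw [β.map_bd₂_id]
  | n + 2, _ =>
    obtain ⟨x, c⟩ := c
    change (⟨x, E.bd n x (β.map (n + 1) x c)⟩ : Σ x : O, E.grp n x) = ⟨x, β.map n x (D.bd n x c)⟩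
    rw [β.map_bd_id]

/-- Freeness of a crossed module is invariant under isomorphism. -/
theorem IsFreeCrossedModuleOn.transfer {M M' : OpFamily O} {μ : ∀ x : O, M.carrier x → (x ⟶ x)}
    {μ' : ∀ x : O, M'.carrier x → (x ⟶ x)} (θ : ∀ x, M.carrier x ≃* M'.carrier x)
    (hact : ∀ {x y : O} (v : x ⟶ y) (c : M.carrier x), θ y (M.act v c) = M'.act v (θ x c))
    (hμ : ∀ (x : O) (c : M.carrier x), μ' x (θ x c) = μ x c)
    {X : Type u} {pt : X → O} {gen : ∀ x, M.carrier (pt x)}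
    (h : IsFreeCrossedModuleOn M μ pt gen) :
    IsFreeCrossedModuleOn M' μ' pt (fun i => θ _ (gen i)) := by
  intro N ν hν f hf
  obtain ⟨Φ, ⟨h₁, h₂, h₃⟩, hΦ⟩ := h N ν hν f (fun i => (hf i).trans (hμ _ _))
  refine ⟨fun y => (Φ y).comp (θ y).symm.toMonoidHom, ⟨fun y z v c => ?_, fun y c => ?_,
    fun i => ?_⟩, ?_⟩
  · obtain ⟨c, rfl⟩ := (θ y).surjective c
    change Φ z ((θ z).symm (M'.act v (θ y c))) = N.act v (Φ y ((θ y).symm (θ y c)))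
    rw [← hact, MulEquiv.symm_apply_apply, MulEquiv.symm_apply_apply, h₁]
  · obtain ⟨c, rfl⟩ := (θ y).surjective c
    change ν y (Φ y ((θ y).symm (θ y c))) = _
    rw [MulEquiv.symm_apply_apply, h₂, hμ]
  · change Φ _ ((θ _).symm (θ _ (gen i))) = _
    rw [MulEquiv.symm_apply_apply, h₃]
  · rintro Ψ ⟨g₁, g₂, g₃⟩
    have key := hΦ (fun y => (Ψ y).comp (θ y).toMonoidHom) ⟨fun y z v c => by
      change Ψ z (θ z (M.act v c)) = _
      rw [hact, g₁]
      rfl, fun y c => (g₂ y (θ y c)).trans (hμ y c), g₃⟩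
    funext y
    ext c
    obtain ⟨c, rfl⟩ := (θ y).surjective c
    change _ = Φ y ((θ y).symm (θ y c))
    rw [MulEquiv.symm_apply_apply]
    exact DFunLike.congr_fun (congrFun key y) c

/-- Freeness of a module is invariant under isomorphism, and under enlarging the set of boundaries
of dimension 2 that have to operate trivially on the modules tested. -/
theorem IsFreeModuleOn.transfer {C C' : CrossedComplex O} {M M' : OpFamily O}
    (θ : ∀ x, M.carrier x ≃* M'.carrier x)
    (hact : ∀ {x y : O} (v : x ⟶ y) (c : M.carrier x), θ y (M.act v c) = M'.act v (θ x c))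
    (hC : ∀ (x : O) (d : C.grp 0 x), ∃ d' : C'.grp 0 x, C'.bd₂ x d' = C.bd₂ x d)
    {X : Type u} {pt : X → O} {gen : ∀ x, M.carrier (pt x)}
    (h : IsFreeModuleOn C M pt gen) :
    IsFreeModuleOn C' M' pt (fun i => θ _ (gen i)) := by
  intro N hN hN' f
  obtain ⟨Φ, ⟨h₁, h₃⟩, hΦ⟩ := h N hN (fun y d c => by
    obtain ⟨d', hd'⟩ := hC y d
    rw [← hd', hN']) f
  refine ⟨fun y => (Φ y).comp (θ y).symm.toMonoidHom, ⟨fun y z v c => ?_, fun i => ?_⟩, ?_⟩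
  · obtain ⟨c, rfl⟩ := (θ y).surjective c
    change Φ z ((θ z).symm (M'.act v (θ y c))) = N.act v (Φ y ((θ y).symm (θ y c)))
    rw [← hact, MulEquiv.symm_apply_apply, MulEquiv.symm_apply_apply, h₁]
  · change Φ _ ((θ _).symm (θ _ (gen i))) = _
    rw [MulEquiv.symm_apply_apply, h₃]
  · rintro Ψ ⟨g₁, g₃⟩
    have key := hΦ (fun y => (Ψ y).comp (θ y).toMonoidHom) ⟨fun y z v c => by
      change Ψ z (θ z (M.act v c)) = _
      rw [hact, g₁]
      rfl, g₃⟩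
    funext y
    ext c
    obtain ⟨c, rfl⟩ := (θ y).surjective c
    change _ = Φ y ((θ y).symm (θ y c))
    rw [MulEquiv.symm_apply_apply]
    exact DFunLike.congr_fun (congrFun key y) c

section

variable (hβ : ∀ n : ℕ, n + 2 ≤ m → ∀ x : O, Function.Bijective (β.map n x))
include hβ

theorem CrossedComplex.IsFreeOn.transfer {n : ℕ} (hn : n ≤ m) {X : Type u} {b : X → D.Elt n}
    (h : D.IsFreeOn n b) : E.IsFreeOn n (fun i => β.elt n (b i)) := by
  match n, hn with
  | 0, _ => exact trivial
  | 1, _ => exact h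
  | 2, hn =>
    exact IsFreeCrossedModuleOn.transfer (fun x => MulEquiv.ofBijective (β.map 0 x) (hβ 0 hn x))
      (fun v c => β.map_act 0 v c) β.map_bd₂ h
  | n + 3, hn =>
    exact IsFreeModuleOn.transfer
      (fun x => MulEquiv.ofBijective (β.map (n + 1) x) (hβ (n + 1) hn x))
      (fun v c => β.map_act (n + 1) v c) (fun x d => ⟨β.map 0 x d, β.map_bd₂ x d⟩) h

theorem CrsHom.elt_surjective {n : ℕ} (hn : n ≤ m) : Function.Surjective (β.elt n) := by
  match n, hn with
  | 0, _ => exact fun x => ⟨x, rfl⟩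
  | 1, _ => exact fun x => ⟨x, rfl⟩
  | n + 2, hn =>
    rintro ⟨x, c⟩
    obtain ⟨c, rfl⟩ := (hβ n hn x).2 c
    exact ⟨⟨x, c⟩, rfl⟩

end

end Transfer

namespace Contraction

variable {O : Type u} [Groupoid.{u} O] {D E : CrossedComplex O} {β : CrsHom (𝟭 O) D E} {m : ℕ}
  {o : O}

/-- Transport of the functions of a contraction along a morphism; meaningful in the dimensions
in which the morphism is bijective. -/
noncomputable def transport (k : Contraction D o) (β : CrsHom (𝟭 O) D E) : Contraction E o where
  h₀ := k.h₀
  h₁ a b v := β.map 0 o (k.h₁ a b v)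
  h n x c := β.map (n + 1) o (k.h n x (Function.invFun (β.map n x) c))

section

variable (hβ : ∀ n : ℕ, n + 2 ≤ m → ∀ x : O, Function.Bijective (β.map n x))
include hβ

theorem transport_h (k : Contraction D o) {n : ℕ} (hn : n + 2 ≤ m) (x : O) (c : D.grp n x) :
    (k.transport β).h n x (β.map n x c) = β.map (n + 1) o (k.h n x c) := by
  change β.map (n + 1) o (k.h n x (Function.invFun (β.map n x) (β.map n x c))) = _
  rw [Function.leftInverse_invFun (hβ n hn x).1]

theorem transport_loopFun (k : Contraction D o) {n : ℕ} (hn : n + 2 ≤ m) (x : O)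
    (c : D.grp n x) : (k.transport β).loopFun n x (β.map n x c) = β.map n o (k.loopFun n x c) := by
  cases n with
  | zero =>
    let f : D.grp 0 o →* E.grp 0 o := β.map 0 o
    change (f (k.h₁ x x (E.bd₂ x (β.map 0 x c))))⁻¹ * E.act 0 (k.h₀ x) (β.map 0 x c) =
      f ((k.h₁ x x (D.bd₂ x c))⁻¹ * D.act 0 (k.h₀ x) c)
    rw [β.map_bd₂_id, map_mul, map_inv, ← β.map_act_id]
  | succ n =>
    change ((k.transport β).h n x (E.bd n x (β.map (n + 1) x c)))⁻¹ *
        E.act (n + 1) (k.h₀ x) (β.map (n + 1) x c) =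
      β.map (n + 1) o ((k.h n x (D.bd n x c))⁻¹ * D.act (n + 1) (k.h₀ x) c)
    rw [β.map_bd_id, transport_h hβ k (by lia), map_mul, map_inv, β.map_act_id]

theorem transport_loop (hm : 1 ≤ m) (k : Contraction D o) (c : D.Elt m) :
    (k.transport β).loop m (β.elt m c) = β.elt m (k.loop m c) := by
  match m, hm with
  | 1, _ => rfl
  | n + 2, _ =>
    rw [loop_eq_loopFun, loop_eq_loopFun]
    change (⟨o, (k.transport β).loopFun n c.1 (β.map n c.1 c.2)⟩ : Σ x : O, E.grp n x) =
      ⟨o, β.map n o (k.loopFun n c.1 c.2)⟩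
    rw [transport_loopFun hβ k le_rfl]

theorem IsContracting.transport {k : Contraction D o} (hk : k.IsContracting m) :
    (k.transport β).IsContracting m := by
  refine IsContracting.of_at (fun hm a b c v w => ?_) (fun hm a b v => ?_)
    (fun n hn => ⟨fun x c d => ?_, fun x y v c => ?_, fun x c => ?_⟩)
  · change β.map 0 o (k.h₁ a c (v ≫ w)) = β.map 0 o (k.h₁ a b v) * β.map 0 o (k.h₁ b c w)
    rw [hk.h₁_mul hm, map_mul]
  · exact (β.map_bd₂_id _).trans (hk.bd₂_h₁ hm a b v)
  · obtain ⟨c, rfl⟩ := (hβ n hn.le x).2 c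
    obtain ⟨d, rfl⟩ := (hβ n hn.le x).2 d
    have := (hk.at hn).mul x c d
    rw [transport_h hβ k hn.le, transport_h hβ k hn.le]
    refine Eq.trans ?_ (map_mul (β.map (n + 1) o) _ _)
    rw [← this]
    exact (congrArg _ (map_mul (β.map n x) c d).symm).trans (transport_h hβ k hn.le x (c * d))
  · obtain ⟨c, rfl⟩ := (hβ n hn.le x).2 c
    have := (hk.at hn).act x y v c
    rw [transport_h hβ k hn.le, ← this]
    exact (congrArg _ (β.map_act n v c).symm).trans (transport_h hβ k hn.le y (D.act n v c))
  · obtain ⟨c, rfl⟩ := (hβ n hn.le x).2 c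
    rw [transport_h hβ k hn.le, transport_loopFun hβ k hn.le, β.map_bd_id, (hk.at hn).bd]

theorem transport_extends (k : Contraction D o) : (k.transport β).Extends m k β := by
  intro n hn c
  match n, hn with
  | 0, _ => rfl
  | 1, _ => rfl
  | n + 2, hn =>
    change (⟨o, (k.transport β).h n c.1 (β.map n c.1 c.2)⟩ : Σ x : O, E.grp (n + 1) x) =
      ⟨o, β.map (n + 1) o (k.h n c.1 c.2)⟩
    rw [transport_h hβ k hn.le]

theorem extends_iff (h : Contraction D o) (k : Contraction E o) :
    k.Extends m h β ↔ ∀ n, n < m → ∀ c : E.Elt n, k.elt n c = (h.transport β).elt n c := by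
  refine ⟨fun hk n hn c => ?_, fun hk n hn c => ?_⟩
  · obtain ⟨c, rfl⟩ := CrsHom.elt_surjective hβ hn.le c
    rw [hk n hn c, transport_extends hβ h n hn c]
  · rw [hk n hn, transport_extends hβ h n hn c]

/-- The extension of a contracting homotopy by one dimension, along a morphism identifying `D`
with the part of `E` in dimensions up to `m`. -/
theorem existsUnique_extension_along (hm : 1 ≤ m) {h : Contraction D o} (hh : h.IsContracting m)
    (hE : E.IsTruncated (m + 1)) {X : Type u} {xt : X → D.Elt m} (hxt : D.IsFreeOn m xt)
    (y : X → E.Elt (m + 1)) (hy : ∀ i, E.bdElt m (y i) = β.elt m (h.loop m (xt i))) :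
    ∃! k : Contraction E o, k.IsContracting (m + 1) ∧ k.Extends m h β ∧
      ∀ i, k.elt m (β.elt m (xt i)) = y i := by
  simp only [extends_iff hβ]
  exact existsUnique_extension hm (hh.transport hβ) hE (hxt.transfer hβ le_rfl) y
    (fun i => (hy i).trans (transport_loop hβ hm h (xt i)).symm)

end

/-- Two contracting homotopies related by a morphism `ξ` on generators of dimension `m` are
related by `ξ` on all elements of dimension `m`. -/
theorem elt_eq_of_generators (hm : 1 ≤ m) {E' : CrossedComplex O} {β' : CrsHom (𝟭 O) D E'}
    {k : Contraction E o} {k' : Contraction E' o} (hk : k.IsContracting (m + 1))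
    (hk' : k'.IsContracting (m + 1)) (ξ : CrsHom (𝟭 O) E E') {X : Type u} {xt : X → D.Elt m}
    (hxt : D.IsFreeOn m xt)
    (hg : ∀ i, k'.elt m (β'.elt m (xt i)) = ξ.elt (m + 1) (k.elt m (β.elt m (xt i))))
    (c : D.Elt m) : k'.elt m (β'.elt m c) = ξ.elt (m + 1) (k.elt m (β.elt m c)) := by
  match m, hm with
  | 1, _ =>
    obtain ⟨a, b, v⟩ := c
    have hfree : IsFreeGroupoidOn O (fun i => (xt i).1) (fun i => (xt i).2.1)
      (fun i => (xt i).2.2) := hxt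
    have key := (hfree.existsUnique_toGroup (E'.grp 0 o)
        (fun i => k'.h₁ _ _ (xt i).2.2)).unique
      (y₁ := fun a b v => k'.h₁ a b v) (y₂ := fun a b v => ξ.map 0 o (k.h₁ a b v))
      ⟨hk'.h₁_mul (by lia), fun _ => rfl⟩
      ⟨fun a b c v w => by rw [hk.h₁_mul (by lia), map_mul], fun i => by
        have h : (⟨o, k'.h₁ _ _ (xt i).2.2⟩ : Σ x : O, E'.grp 0 x) =
          ⟨o, ξ.map 0 o (k.h₁ _ _ (xt i).2.2)⟩ := hg i
        exact (eq_of_heq (Sigma.mk.inj h).2).symm⟩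
    change (⟨o, k'.h₁ a b v⟩ : Σ x : O, E'.grp 0 x) = ⟨o, ξ.map 0 o (k.h₁ a b v)⟩
    rw [congrFun (congrFun (congrFun key a) b) v]
  | n + 2, _ =>
    have hat := hk.at (n := n) (by lia)
    have hat' := hk'.at (n := n) (by lia)
    have key := (CrossedComplex.IsFreeOn.hasInvariantLifts hxt).ext (E'.comm n o)
      (Φ := fun x => (MonoidHom.mk' (k'.h n x) (hat'.mul x)).comp (β'.map n x))
      (Ψ := fun x => (ξ.map (n + 1) o).comp
        ((MonoidHom.mk' (k.h n x) (hat.mul x)).comp (β.map n x)))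
      (fun y z v c => by
        change k'.h n z (β'.map n z (D.act n v c)) = k'.h n y (β'.map n y c)
        rw [β'.map_act_id, hat'.act])
      (fun y z v c => by
        change ξ.map (n + 1) o (k.h n z (β.map n z (D.act n v c))) =
          ξ.map (n + 1) o (k.h n y (β.map n y c))
        rw [β.map_act_id, hat.act])
      (fun i => by
        have h : (⟨o, k'.h n (xt i).1 (β'.map n (xt i).1 (xt i).2)⟩ :
            Σ x : O, E'.grp (n + 1) x) =
          ⟨o, ξ.map (n + 1) o (k.h n (xt i).1 (β.map n (xt i).1 (xt i).2))⟩ := hg i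
        exact eq_of_heq (Sigma.mk.inj h).2)
    have hc := DFunLike.congr_fun (congrFun key c.1) c.2
    change (⟨o, k'.h n c.1 (β'.map n c.1 c.2)⟩ : Σ x : O, E'.grp (n + 1) x) =
      ⟨o, ξ.map (n + 1) o (k.h n c.1 (β.map n c.1 c.2))⟩
    exact congrArg _ hc

end Contraction

/-! ### The universal cover inherits bases -/

section CoverFree

variable {F G : Type u} [Group F] [Group G] {φ : F →* G}

/-- The groups of sections `g ↦ n g` of a family over the universal covering groupoid, with the
operation `(n ^ v) (g * φ v) = (n g) ^ (g, v)`. Passing to sections is right adjoint to passing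
to the universal cover. -/
def sections (N : OpFamily (CovObj φ)) : OpFamily (OneObj F) where
  carrier _ := ∀ g : CovObj φ, N.carrier g
  act v :=
    { toFun := fun n g => N.act (x := CovObj.of φ (g.val * (φ (OneObj.val v))⁻¹))
        ⟨OneObj.val v, inv_mul_cancel_right _ _⟩ (n _)
      map_one' := funext fun g => map_one _
      map_mul' := fun n n' => funext fun g => map_mul _ _ _ }
  act_id x n := funext fun g => by
    have key : ∀ (a : CovObj φ) (w : a ⟶ g), w.1 = 1 → N.act w (n a) = n g := by
      rintro a ⟨w, hw⟩ rfl
      obtain rfl : a = g := by rw [map_one, mul_one] at hw; exact hw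
      exact N.act_id _ _
    exact key _ _ rfl
  act_comp {x y z} v w n := funext fun g => by
    have key : ∀ (a b c : CovObj φ) (v' : b ⟶ g) (w' : c ⟶ b) (t : a ⟶ g), t.1 = w'.1 * v'.1 →
        N.act t (n a) = N.act v' (N.act w' (n c)) := by
      intro a b c v' w' t ht
      obtain rfl : a = c := by
        have h₁ : a.val * (φ w'.1 * φ v'.1) = c.val * φ w'.1 * φ v'.1 := by
          rw [← map_mul, ← ht]
          exact t.2.trans (v'.2.symm.trans (congrArg (· * φ v'.1) w'.2.symm))
        rw [← mul_assoc] at h₁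
        have h₂ : a.val = c.val := mul_right_cancel (mul_right_cancel h₁)
        exact h₂
      obtain rfl : t = w' ≫ v' := Subtype.ext ht
      exact N.act_comp _ _ _
    exact key _ _ _ _ _ _ rfl

/-- The operation on sections along any arrow over a given element of `F`; its source is
determined by its target. -/
theorem sections_act_apply (N : OpFamily (CovObj φ)) {a b : OneObj F} (n : ∀ g, N.carrier g)
    {g g' : CovObj φ} (w : g ⟶ g') :
    (sections N).act (x := a) (y := b) (OneObj.arr w.1) n g' = N.act w (n g) := by
  have key : ∀ (c : CovObj φ) (t : c ⟶ g'), t.1 = w.1 → N.act t (n c) = N.act w (n g) := by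
    intro c t ht
    obtain rfl : c = g := by
      have h₁ : c.val * φ w.1 = g.val * φ w.1 := by
        rw [← ht]
        exact t.2.trans (w.2.symm.trans (by rw [ht]))
      have h₂ : c.val = g.val := mul_right_cancel h₁
      exact h₂
    obtain rfl : t = w := Subtype.ext ht
    rfl
  exact key _ _ rfl

/-- The crossed module of those sections whose boundary is the same element of `F` everywhere. -/
def crossedSections (N : OpFamily (CovObj φ)) (ν : ∀ g, N.carrier g → (g ⟶ g))
    (hν : IsCrossedModule N ν) : OpFamily (OneObj F) where
  carrier _ :=
    ({ carrier := {n | ∀ g, (ν g (n g)).1 = (ν (CovObj.base φ) (n _)).1}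
       one_mem' := fun g => by
        change (ν g 1).1 = (ν _ 1).1
        rw [hν.map_one, hν.map_one]
        rfl
       mul_mem' := fun {n n'} hn hn' g => by
        change (ν g (n g * n' g)).1 = (ν _ (n _ * n' _)).1
        rw [hν.map_mul, hν.map_mul]
        exact congrArg₂ HMul.hMul (hn g) (hn' g)
       inv_mem' := fun {n} hn g => by
        change (ν g (n g)⁻¹).1 = (ν _ (n _)⁻¹).1
        rw [hν.map_inv, hν.map_inv]
        exact congrArg Inv.inv (hn g) } : Subgroup (∀ g : CovObj φ, N.carrier g))
  act {a b} v :=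
    { toFun := fun n => ⟨(sections N).act v n.1, fun g => by
        have key : ∀ g, (ν g ((sections N).act v n.1 g)).1 =
            (OneObj.val v)⁻¹ * ((ν (CovObj.base φ) (n.1 _)).1 * OneObj.val v) := by
          intro g
          refine (congrArg Subtype.val (hν.map_act _ _)).trans ?_
          exact congrArg (fun u : F => (OneObj.val v)⁻¹ * (u * OneObj.val v)) (n.2 _)
        exact (key g).trans (key _).symm⟩
      map_one' := Subtype.ext (map_one ((sections N).act v))
      map_mul' := fun n n' => Subtype.ext (map_mul ((sections N).act v) n.1 n'.1) }
  act_id x n := Subtype.ext ((sections N).act_id x n.1)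
  act_comp v w n := Subtype.ext ((sections N).act_comp v w n.1)

theorem isCrossedModule_crossedSections (N : OpFamily (CovObj φ)) (ν : ∀ g, N.carrier g → (g ⟶ g))
    (hν : IsCrossedModule N ν) :
    IsCrossedModule (crossedSections N ν hν) (fun _ n => (ν (CovObj.base φ) (n.1 _)).1) where
  map_mul _ n n' := congrArg Subtype.val (hν.map_mul _ (n.1 _) (n'.1 _))
  map_act v n := (congrArg Subtype.val (hν.map_act _ _)).trans
    (congrArg (fun u : F => (OneObj.val v)⁻¹ * (u * OneObj.val v)) (n.2 _))
  peiffer x n n' := Subtype.ext (funext fun g => by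
    have h₁ := sections_act_apply N (a := x) (b := x) n.1 (ν g (n'.1 g))
    rw [hν.peiffer, n'.2 g] at h₁
    exact h₁)

variable {C : CrossedComplex (OneObj F)} {hφ : Augments C (OneObj.functor φ)} {Z : Type u}

/-- Morphisms from the cover to `N` are morphisms from `C` to the crossed sections of `N`. -/
theorem isFreeOn_cover_two {z : Z → C.Elt 2} (h : C.IsFreeOn 2 z) :
    (cover C φ hφ).IsFreeOn 2 (fun i : G × Z => cover.lift C φ hφ i.1 2 (z i.2)) := by
  intro N ν hν f hf
  obtain ⟨Φ, ⟨h₁, h₂, h₃⟩, hΦ⟩ := h (crossedSections N ν hν) _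
    (isCrossedModule_crossedSections N ν hν)
    (fun i => ⟨fun g => f (g, i), fun g =>
      (congrArg Subtype.val (hf (g, i))).trans (congrArg Subtype.val (hf (1, i))).symm⟩)
    (fun i => congrArg Subtype.val (hf (1, i)))
  refine ⟨fun g =>
    { toFun := fun c => (Φ (OneObj.pt F) c).1 g
      map_one' := congrFun (congrArg Subtype.val (map_one (Φ (OneObj.pt F)))) g
      map_mul' := fun c d =>
        congrFun (congrArg Subtype.val (map_mul (Φ (OneObj.pt F)) c d)) g },
    ⟨fun g g' w c => ?_, fun g c => Subtype.ext ?_, fun i => ?_⟩, ?_⟩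
  · exact (congrFun (congrArg Subtype.val (h₁ _ _ (OneObj.arr w.1) c)) g').trans
      (sections_act_apply N _ w)
  · exact ((Φ (OneObj.pt F) c).2 g).trans (h₂ (OneObj.pt F) c)
  · exact congrFun (congrArg Subtype.val (h₃ i.2)) i.1
  · rintro Ψ ⟨g₁, g₂, g₃⟩
    have key := hΦ (fun _ =>
      { toFun := fun c => ⟨fun g => Ψ g c, fun g =>
          (congrArg Subtype.val (g₂ g c)).trans (congrArg Subtype.val (g₂ (CovObj.base φ) c)).symm⟩
        map_one' := Subtype.ext (funext fun g => map_one (Ψ g))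
        map_mul' := fun c d => Subtype.ext (funext fun g => map_mul (Ψ g) c d) })
      ⟨fun _ _ v c => Subtype.ext (funext fun g => g₁ _ g
          ⟨OneObj.val v, inv_mul_cancel_right _ _⟩ c),
        fun _ c => congrArg Subtype.val (g₂ _ c), fun i => Subtype.ext (funext fun g => g₃ (g, i))⟩
    funext g
    ext c
    exact congrFun (congrArg Subtype.val (DFunLike.congr_fun (congrFun key (OneObj.pt F)) c)) g

theorem isFreeOn_cover_add_three {n : ℕ} {z : Z → C.Elt (n + 3)} (h : C.IsFreeOn (n + 3) z) :
    (cover C φ hφ).IsFreeOn (n + 3)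
      (fun i : G × Z => cover.lift C φ hφ i.1 (n + 3) (z i.2)) := by
  intro N hN hN' f
  obtain ⟨Φ, ⟨h₁, h₃⟩, hΦ⟩ := h (sections N)
    (fun _ c d => funext fun g => hN g (c g) (d g))
    (fun x d c => funext fun g => (sections_act_apply N c ((cover C φ hφ).bd₂ g d)).trans
      (hN' g d (c g)))
    (fun i g => f (g, i))
  refine ⟨fun g =>
    { toFun := fun c => Φ (OneObj.pt F) c g
      map_one' := congrFun (map_one (Φ (OneObj.pt F))) g
      map_mul' := fun c d => congrFun (map_mul (Φ (OneObj.pt F)) c d) g },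
    ⟨fun g g' w c => ?_, fun i => ?_⟩, ?_⟩
  · exact (congrFun (h₁ _ _ (OneObj.arr w.1) c) g').trans (sections_act_apply N _ w)
  · exact congrFun (h₃ i.2) i.1
  · rintro Ψ ⟨g₁, g₃⟩
    have key := hΦ (fun _ =>
      { toFun := fun c g => Ψ g c
        map_one' := funext fun g => map_one (Ψ g)
        map_mul' := fun c d => funext fun g => map_mul (Ψ g) c d })
      ⟨fun _ _ v c => funext fun g => g₁ _ g ⟨OneObj.val v, inv_mul_cancel_right _ _⟩ c,
        fun i => funext fun g => g₃ (g, i)⟩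
    funext g
    ext c
    exact congrFun (DFunLike.congr_fun (congrFun key (OneObj.pt F)) c) g

/-- For a function `f₀` from `G` to the objects of a groupoid, the group of pairs of an element
`γ` of `G` and a family of arrows `f₀ g ⟶ f₀ (g * γ)`. Morphisms from `F` to this group, over
`φ`, are the functors from the universal cover of `F` which are `f₀` on objects. -/
structure Wreath (φ : F →* G) {H : Type u} [Groupoid.{u} H] (f₀ : CovObj φ → H) where
  shift : G
  arrow : ∀ g g' : CovObj φ, g.val * shift = g'.val → (f₀ g ⟶ f₀ g')

namespace Wreath

variable {H : Type u} [Groupoid.{u} H] {f₀ : CovObj φ → H}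

theorem ext {p q : Wreath φ f₀} (h : p.shift = q.shift)
    (h' : ∀ g g' hp hq, p.arrow g g' hp = q.arrow g g' hq) : p = q := by
  obtain ⟨γ, a⟩ := p
  obtain ⟨δ, b⟩ := q
  obtain rfl : γ = δ := h
  congr
  funext g g' hg
  exact h' g g' hg hg

theorem arrow_congr {p q : Wreath φ f₀} (h : p = q) {g g' : CovObj φ} (hp) (hq) :
    p.arrow g g' hp = q.arrow g g' hq := by
  subst h
  rfl

theorem eqToHom_comp_arrow (p : Wreath φ f₀) {g₁ g g' : CovObj φ} (h : g₁ = g) (hp) (hq) :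
    eqToHom (congrArg f₀ h) ≫ p.arrow g g' hp = p.arrow g₁ g' hq := by
  subst h
  exact Category.id_comp _

instance : Mul (Wreath φ f₀) where
  mul p q := ⟨p.shift * q.shift, fun g g' h =>
    p.arrow g (CovObj.of φ (g.val * p.shift)) rfl ≫
      q.arrow (CovObj.of φ (g.val * p.shift)) g' (by rw [← h, ← mul_assoc]; rfl)⟩

theorem mul_arrow (p q : Wreath φ f₀) {g g' g'' : CovObj φ} (h : g.val * (p * q).shift = g''.val)
    (hp : g.val * p.shift = g'.val) (hq : g'.val * q.shift = g''.val) :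
    (p * q).arrow g g'' h = p.arrow g g' hp ≫ q.arrow g' g'' hq := by
  obtain rfl : CovObj.of φ (g.val * p.shift) = g' := hp
  rfl

instance : One (Wreath φ f₀) where
  one := ⟨1, fun g _ h => eqToHom (congrArg f₀ ((mul_one g.val).symm.trans h))⟩

instance : Inv (Wreath φ f₀) where
  inv p := ⟨p.shift⁻¹, fun g g' h => Groupoid.inv (p.arrow g' g (by
    rw [← h, inv_mul_cancel_right]))⟩

instance : Group (Wreath φ f₀) :=
  Group.ofLeftAxioms
    (fun p q r => ext (mul_assoc p.shift q.shift r.shift) fun g g' h₁ h₂ => by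
      obtain ⟨a, ha⟩ : ∃ a : CovObj φ, g.val * p.shift = a.val := ⟨CovObj.of φ _, rfl⟩
      obtain ⟨b, hb⟩ : ∃ b : CovObj φ, a.val * q.shift = b.val := ⟨CovObj.of φ _, rfl⟩
      have hab : g.val * (p * q).shift = b.val := by
        rw [← hb, ← ha]
        exact (mul_assoc _ _ _).symm
      have hqr : a.val * (q * r).shift = g'.val := by
        rw [← h₂, ← ha]
        exact mul_assoc g.val p.shift (q.shift * r.shift)
      have hr : b.val * r.shift = g'.val := by
        rw [← hqr, ← hb]
        exact mul_assoc a.val q.shift r.shift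
      rw [mul_arrow (p * q) r h₁ hab hr, mul_arrow p q hab ha hb, mul_arrow p (q * r) h₂ ha hqr,
        mul_arrow q r hqr hb hr, Category.assoc])
    (fun p => ext (one_mul p.shift) fun g g' h₁ h₂ =>
      (mul_arrow 1 p h₁ (g' := g) (mul_one g.val) h₂).trans
        (eqToHom_comp_arrow p (g₁ := g) (g := g) rfl h₂ h₂))
    (fun p => ext (inv_mul_cancel p.shift) fun g g' h₁ h₂ => by
      obtain rfl : g = g' := (mul_one g.val).symm.trans h₂
      exact (mul_arrow p⁻¹ p h₁ (g' := CovObj.of φ (g.val * p.shift⁻¹)) rfl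
        (inv_mul_cancel_right _ _)).trans (Groupoid.inv_comp _))

end Wreath

/-- The morphism from `F` to `Wreath φ f₀` determined by the values on the generators has `φ` as its
component in `G`; its components in the groupoid are the values of the functor sought. -/
theorem isFreeOn_cover_one {z : Z → C.Elt 1} (h : C.IsFreeOn 1 z) :
    (cover C φ hφ).IsFreeOn 1 (fun i : G × Z => cover.lift C φ hφ i.1 1 (z i.2)) := by
  intro H _ f₀ f
  let ζ : Z → F := fun i => OneObj.val (z i).2.2
  have hfree : IsFreeGroupoidOn (OneObj F) (fun _ => OneObj.pt F) (fun _ => OneObj.pt F)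
    (fun i => OneObj.arr (ζ i)) := h
  let f' : ∀ i : G × Z, f₀ (CovObj.of φ i.1) ⟶ f₀ (CovObj.of φ (i.1 * φ (ζ i.2))) := f
  let gen : Z → Wreath φ f₀ := fun i => ⟨φ (ζ i), fun g g' hg =>
    f' (g.val, i) ≫ eqToHom (congrArg f₀ hg)⟩
  obtain ⟨Θ, ⟨h₁, h₂⟩, hΘ⟩ := hfree.existsUnique_toGroup (Wreath φ f₀) gen
  have hshift : ∀ a b (v : a ⟶ b), (Θ a b v).shift = φ (OneObj.val v) := by
    have key := (hfree.existsUnique_toGroup G fun i => φ (ζ i)).unique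
      (y₁ := fun a b v => (Θ a b v).shift) (y₂ := fun a b v => φ (OneObj.val v))
      ⟨fun a b c v w => congrArg Wreath.shift (h₁ a b c v w),
        fun i => congrArg Wreath.shift (h₂ i)⟩
      ⟨fun a b c v w => map_mul φ (OneObj.val v) (OneObj.val w), fun i => rfl⟩
    exact fun a b v => congrFun (congrFun (congrFun key a) b) v
  have hsh : ∀ {g g' : CovObj φ} (w : g ⟶ g'),
      g.val * (Θ (OneObj.pt F) (OneObj.pt F) (OneObj.arr w.1)).shift = g'.val := fun w => by
    rw [hshift]
    exact w.2
  refine ⟨fun g g' w => (Θ (OneObj.pt F) (OneObj.pt F) (OneObj.arr w.1)).arrow g g' (hsh w),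
    ⟨fun a b c v w => ?_, fun i => ?_⟩, ?_⟩
  · have e := h₁ _ _ _ (OneObj.arr v.1) (OneObj.arr w.1)
    rw [← Wreath.mul_arrow _ _ (by rw [← e]; exact hsh (v ≫ w)) (hsh v) (hsh w)]
    exact Wreath.arrow_congr e _ _
  · exact (Wreath.arrow_congr (h₂ i.2) _ rfl).trans (Category.comp_id _)
  · rintro Ψ ⟨g₁, g₂⟩
    have key := hΘ (fun _ _ v => ⟨φ (OneObj.val v), fun g g' hg => Ψ g g' ⟨OneObj.val v, hg⟩⟩)
      ⟨fun a b c v w => ?_, fun i => Wreath.ext rfl fun g g' hp hq => ?_⟩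
    · funext g g' w
      exact Wreath.arrow_congr
        (congrFun (congrFun (congrFun key (OneObj.pt F)) (OneObj.pt F)) (OneObj.arr w.1)) w.2 _
    · refine Wreath.ext (map_mul φ (OneObj.val v) (OneObj.val w)) fun g g' hp hq => ?_
      exact g₁ g (CovObj.of φ (g.val * φ (OneObj.val v))) g' ⟨OneObj.val v, rfl⟩
        ⟨OneObj.val w, (mul_assoc (G := G) _ _ _).trans hq⟩
    · obtain rfl : CovObj.of φ (g.val * φ (ζ i)) = g' := hp
      exact (g₂ (g, i)).trans (Category.comp_id _).symm

/-- The inverse image of a basis of `C` is a basis of the universal cover. -/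
theorem isFreeOn_cover {n : ℕ} {z : Z → C.Elt n} (h : C.IsFreeOn n z) :
    (cover C φ hφ).IsFreeOn n (fun i : G × Z => cover.lift C φ hφ i.1 n (z i.2)) := by
  match n with
  | 0 => exact trivial
  | 1 => exact isFreeOn_cover_one h
  | 2 => exact isFreeOn_cover_two h
  | n + 3 => exact isFreeOn_cover_add_three h

theorem isCovering_cover_proj : (cover.proj C φ hφ).IsCovering := by
  refine ⟨⟨fun g => ⟨?_, ?_⟩, fun g => ⟨?_, ?_⟩⟩, fun n x => Function.bijective_id⟩
  · rintro ⟨a, v, hv⟩ ⟨b, w, hw⟩ h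
    obtain rfl : v = w := eq_of_heq (Sigma.mk.inj h).2
    obtain rfl : a = b := hv.symm.trans hw
    rfl
  · rintro ⟨a, v⟩
    exact ⟨⟨CovObj.of φ (g.val * φ (OneObj.val v)), ⟨OneObj.val v, rfl⟩⟩, rfl⟩
  · rintro ⟨a, v, hv⟩ ⟨b, w, hw⟩ h
    obtain rfl : v = w := eq_of_heq (Sigma.mk.inj h).2
    have h₁ : a.val = b.val := mul_right_cancel (hv.trans hw.symm)
    obtain rfl : a = b := h₁
    rfl
  · rintro ⟨a, v⟩
    exact ⟨⟨CovObj.of φ (g.val * (φ (OneObj.val v))⁻¹),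
      ⟨OneObj.val v, inv_mul_cancel_right _ _⟩⟩, rfl⟩

theorem IsFreeResolution.surjective {m : ℕ} (h : IsFreeResolution m C (OneObj.functor φ)) :
    Function.Surjective φ := h.map_surjective (OneObj.pt F) (OneObj.pt F)

theorem isFreeResolution_cover {m : ℕ} (h : IsFreeResolution m C (OneObj.functor φ)) :
    IsFreeResolution m (cover C φ hφ) (CovObj.toUniv φ) where
  truncated n _ hn := h.truncated n (OneObj.pt F) hn
  free n h₁ h₂ := by
    obtain ⟨Z, z, hz⟩ := h.free n h₁ h₂
    exact ⟨_, _, isFreeOn_cover hz⟩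
  obj_bijective := Function.bijective_id
  map_surjective a b w := by
    obtain ⟨v, hv⟩ := h.surjective w.1
    exact ⟨⟨v, by rw [hv]; exact w.2⟩, Subtype.ext hv⟩
  augments _ c := Subtype.ext (hφ (OneObj.pt F) c)
  exact₁ hm g v hv := by
    obtain ⟨c, hc⟩ := h.exact₁ hm (OneObj.pt F) (OneObj.arr v.1) (congrArg Subtype.val hv)
    exact ⟨c, Subtype.ext hc⟩
  exact₂ hm _ c hc := h.exact₂ hm (OneObj.pt F) c (congrArg Subtype.val hc)
  exact n hn _ c hc := h.exact n hn (OneObj.pt F) c hc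

end CoverFree

/-! ### Free modules and free crossed modules over a group -/

section FreeModule

variable {F G : Type u} [Group F] [Group G] (φ : F →* G) (Y : Type u)

/-- The free `G`-module on `Y`, as a family with operation of `F`: the free abelian group on the
pairs `(y, g)`, which stand for `y ^ g`. -/
def freeModule : OpFamily (OneObj F) where
  carrier _ := Abelianization (FreeGroup (Y × G))
  act v := Abelianization.map (FreeGroup.map fun p => (p.1, p.2 * φ (OneObj.val v)))
  act_id _ c := by
    refine DFunLike.congr_fun (f := Abelianization.map _) (g := MonoidHom.id _) ?_ c
    ext p
    exact congrArg (fun q => Abelianization.of (FreeGroup.of q))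
      (Prod.ext rfl ((congrArg (p.2 * ·) (map_one φ)).trans (mul_one p.2)))
  act_comp v w c := by
    refine DFunLike.congr_fun (f := Abelianization.map _)
      (g := (Abelianization.map _).comp (Abelianization.map _)) ?_ c
    ext p
    exact congrArg (fun q => Abelianization.of (FreeGroup.of q)) (Prod.ext rfl
      ((congrArg (p.2 * ·) (map_mul φ (OneObj.val v) (OneObj.val w))).trans
        (mul_assoc _ _ _).symm))

variable {Y}

/-- The element `y ^ g` of the free module. -/
def freeModule.basis (y : Y) (g : G) (x : OneObj F) : (freeModule φ Y).carrier x :=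
  (Abelianization.of (FreeGroup.of (y, g)) : Abelianization (FreeGroup (Y × G)))

theorem freeModule.act_basis (y : Y) (g : G) {a b : OneObj F} (v : a ⟶ b) :
    (freeModule φ Y).act v (freeModule.basis φ y g a) =
      freeModule.basis φ y (g * φ (OneObj.val v)) b := rfl

theorem freeModule.hom_ext {A : Type u} [Group A] (hA : ∀ a b : A, a * b = b * a) {x : OneObj F}
    {f g : (freeModule φ Y).carrier x →* A}
    (h : ∀ y a, f (freeModule.basis φ y a x) = g (freeModule.basis φ y a x)) : f = g := by
  let _ : CommGroup A := { (inferInstance : Group A) with mul_comm := hA }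
  refine Abelianization.hom_ext (G := FreeGroup (Y × G)) f g ?_
  ext p
  exact h p.1 p.2

theorem freeModule_comm (x : OneObj F) (c d : (freeModule φ Y).carrier x) : c * d = d * c :=
  mul_comm (G := Abelianization (FreeGroup (Y × G))) c d

theorem freeModule_subsingleton [IsEmpty Y] (x : OneObj F) :
    Subsingleton ((freeModule φ Y).carrier x) :=
  (QuotientGroup.mk_surjective (s := commutator (FreeGroup (Y × G)))).subsingleton

theorem freeModule_act_of_map_eq_one {x : OneObj F} {v : x ⟶ x} (hv : φ (OneObj.val v) = 1)
    (c : (freeModule φ Y).carrier x) : (freeModule φ Y).act v c = c := by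
  refine DFunLike.congr_fun (f := (freeModule φ Y).act v) (g := MonoidHom.id _)
    (freeModule.hom_ext φ (freeModule_comm φ x) fun y a => ?_) c
  rw [freeModule.act_basis, hv, mul_one]
  rfl

theorem isFreeModuleOn_freeModule {φ : F →* G} {C : CrossedComplex (OneObj F)}
    (hφ : Function.Surjective φ)
    (hC : ∀ v : F, φ v = 1 → ∃ c, C.bd₂ (OneObj.pt F) c = OneObj.arr v) {Z : Type u}
    (ε : Z ≃ Y) :
    IsFreeModuleOn C (freeModule φ Y) (fun _ : Z => OneObj.pt F)
      (fun i => freeModule.basis φ (ε i) 1 (OneObj.pt F)) := by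
  intro N hN hN' f
  let P := OneObj.pt F
  -- Elements of `F` with the same image in `G` operate on `N` in the same way.
  have hact : ∀ (v w : F) (c : N.carrier P), φ v = φ w →
      N.act (OneObj.arr v) c = N.act (OneObj.arr w) c := by
    intro v w c hvw
    obtain ⟨e, he⟩ := hC (v * w⁻¹) (by rw [map_mul, map_inv, hvw, mul_inv_cancel])
    have h₁ := hN' P e c
    rw [he] at h₁
    have h₂ : OneObj.arr v = OneObj.arr (v * w⁻¹) ≫ OneObj.arr w :=
      (inv_mul_cancel_right v w).symm
    rw [h₂, N.act_comp, h₁]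
  let r : G → F := Function.surjInv hφ
  have hr : ∀ g, φ (r g) = g := Function.surjInv_eq hφ
  let _ : CommGroup (N.carrier P) := { (inferInstance : Group (N.carrier P)) with mul_comm := hN P }
  let Φ : Abelianization (FreeGroup (Y × G)) →* N.carrier P := Abelianization.lift
    (FreeGroup.lift fun p => N.act (OneObj.arr (r p.2)) (f (ε.symm p.1)))
  have hΦ : ∀ y g, Φ (Abelianization.of (FreeGroup.of (y, g))) =
      N.act (OneObj.arr (r g)) (f (ε.symm y)) := fun y g =>
    (Abelianization.lift_apply_of _ _).trans FreeGroup.lift_apply_of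
  refine ⟨fun _ => Φ, ⟨fun y z v c => ?_, fun i => ?_⟩, ?_⟩
  · refine DFunLike.congr_fun (f := MonoidHom.comp (Φ : (freeModule φ Y).carrier z →* N.carrier z)
      ((freeModule φ Y).act v)) (g := (N.act v).comp Φ)
      (freeModule.hom_ext φ (hN z) fun a g => ?_) c
    refine (hΦ a (g * φ (OneObj.val v))).trans (Eq.trans ?_ (congrArg (N.act v) (hΦ a g)).symm)
    refine Eq.trans ?_ (N.act_comp (OneObj.arr (r g)) v _)
    refine hact _ (r g * OneObj.val v) _ ?_
    rw [hr, map_mul, hr]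
  · refine (hΦ (ε i) 1).trans ?_
    rw [ε.symm_apply_apply, hact (r 1) 1 _ (by rw [hr, map_one])]
    exact N.act_id _ _
  · rintro Ψ ⟨h₁, h₂⟩
    funext x
    refine freeModule.hom_ext φ (hN x) fun y g => ?_
    refine Eq.trans ?_ (hΦ y g).symm
    rw [← h₂ (ε.symm y)]
    refine Eq.trans (congrArg (Ψ x) ?_) (h₁ P x (OneObj.arr (r g)) _)
    rw [freeModule.act_basis, ε.apply_symm_apply]
    refine congrArg (fun a => freeModule.basis φ y a x) ?_
    exact ((one_mul _).trans (hr g)).symm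

end FreeModule

section FreeCrossedModule

variable {F : Type u} [Group F] {Z : Type u} (d : Z → F)

/-- The operation of `v` on the free group on the pairs `(z, w)`, which stand for `z ^ w`. -/
def preAct (Z : Type u) (v : F) : FreeGroup (Z × F) →* FreeGroup (Z × F) :=
  FreeGroup.map fun p => (p.1, p.2 * v)

/-- The boundary on the free group on the pairs `(z, w)`, extending the conjugates of `d`. -/
def preBd : FreeGroup (Z × F) →* F := FreeGroup.lift fun p => p.2⁻¹ * d p.1 * p.2

theorem preAct_one (a : FreeGroup (Z × F)) : preAct Z (1 : F) a = a := by
  refine DFunLike.congr_fun (f := preAct Z (1 : F)) (g := MonoidHom.id _) ?_ a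
  ext p
  simp [preAct]

theorem preAct_mul (v w : F) (a : FreeGroup (Z × F)) :
    preAct Z (v * w) a = preAct Z w (preAct Z v a) := by
  refine DFunLike.congr_fun (f := preAct Z (v * w)) (g := (preAct Z w).comp (preAct Z v)) ?_ a
  ext p
  simp [preAct, mul_assoc]

theorem preBd_preAct (v : F) (a : FreeGroup (Z × F)) :
    preBd d (preAct Z v a) = v⁻¹ * preBd d a * v := by
  have h : (preBd d).comp (preAct Z v) =
      (MulAut.conj v⁻¹).toMonoidHom.comp (preBd d) := by
    ext p
    simp [preAct, preBd, mul_assoc]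
  have := DFunLike.congr_fun h a
  simpa using this

/-- The normal subgroup generated by the Peiffer elements. -/
def peiffer : Subgroup (FreeGroup (Z × F)) :=
  Subgroup.normalClosure {c | ∃ a b, c = (preAct Z (preBd d b) a)⁻¹ * (b⁻¹ * a * b)}

instance : (peiffer d).Normal := Subgroup.normalClosure_normal

theorem peiffer_le_ker : peiffer d ≤ (preBd d).ker := by
  refine Subgroup.normalClosure_le_normal ?_
  rintro _ ⟨a, b, rfl⟩
  change preBd d _ = 1
  rw [map_mul, map_inv, preBd_preAct, map_mul, map_mul, map_inv, inv_mul_cancel]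

theorem peiffer_le_comap_preAct (v : F) : peiffer d ≤ (peiffer d).comap (preAct Z v) := by
  refine Subgroup.normalClosure_le_normal ?_
  rintro _ ⟨a, b, rfl⟩
  refine Subgroup.subset_normalClosure ⟨preAct Z v a, preAct Z v b, ?_⟩
  rw [preBd_preAct, ← preAct_mul, map_mul, map_inv, ← preAct_mul, map_mul, map_mul, map_inv]
  congr 4
  group

/-- The free crossed `F`-module on the function `d`: the quotient of the free group on the pairs
`(z, w)`, which stand for `z ^ w`, by the Peiffer elements. -/
def freeCrossedModule : OpFamily (OneObj F) where
  carrier _ := FreeGroup (Z × F) ⧸ peiffer d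
  act v := QuotientGroup.map _ _ (preAct Z (OneObj.val v)) (peiffer_le_comap_preAct d _)
  act_id _ c := by
    obtain ⟨a, rfl⟩ := QuotientGroup.mk_surjective c
    exact congrArg QuotientGroup.mk (preAct_one a)
  act_comp v w c := by
    obtain ⟨a, rfl⟩ := QuotientGroup.mk_surjective c
    exact congrArg QuotientGroup.mk (preAct_mul (OneObj.val v) (OneObj.val w) a)

/-- The boundary of the free crossed module. -/
def freeCrossedModule.bd (x : OneObj F) (c : (freeCrossedModule d).carrier x) : x ⟶ x :=
  (QuotientGroup.lift (peiffer d) (preBd d) (peiffer_le_ker d) :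
    FreeGroup (Z × F) ⧸ peiffer d →* F) c

theorem isCrossedModule_freeCrossedModule :
    IsCrossedModule (freeCrossedModule d) (freeCrossedModule.bd d) where
  map_mul x c c' := map_mul (QuotientGroup.lift (peiffer d) (preBd d) (peiffer_le_ker d)) c c'
  map_act {x y} v c := by
    obtain ⟨a, rfl⟩ := QuotientGroup.mk_surjective c
    exact (preBd_preAct d (OneObj.val v) a).trans (mul_assoc _ _ _)
  peiffer x c c' := by
    obtain ⟨a, rfl⟩ := QuotientGroup.mk_surjective c
    obtain ⟨b, rfl⟩ := QuotientGroup.mk_surjective c'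
    exact QuotientGroup.eq.2 (Subgroup.subset_normalClosure ⟨a, b, rfl⟩)

theorem isFreeCrossedModuleOn_freeCrossedModule :
    IsFreeCrossedModuleOn (freeCrossedModule d) (freeCrossedModule.bd d)
      (fun _ : Z => OneObj.pt F)
      (fun i => (QuotientGroup.mk (FreeGroup.of (i, 1)) : FreeGroup (Z × F) ⧸ peiffer d)) := by
  intro N ν hν f hf
  let P := OneObj.pt F
  let ν' : N.carrier P →* F := MonoidHom.mk' (fun c => OneObj.val (ν P c)) (hν.map_mul P)
  let Φ₀ : FreeGroup (Z × F) →* N.carrier P :=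
    FreeGroup.lift fun p => N.act (OneObj.arr p.2) (f p.1)
  have hΦ₀ : ∀ p, Φ₀ (FreeGroup.of p) = N.act (OneObj.arr p.2) (f p.1) := fun p =>
    FreeGroup.lift_apply_of
  have hf' : ∀ i, ν' (f i) = d i := fun i => (hf i).trans (by
    change FreeGroup.lift _ (FreeGroup.of _) = _
    simp)
  have hν₀ : ν'.comp Φ₀ = preBd d := by
    ext p
    change ν' (Φ₀ (FreeGroup.of p)) = preBd d (FreeGroup.of p)
    rw [hΦ₀]
    refine (hν.map_act (OneObj.arr p.2) (f p.1)).trans ?_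
    change p.2⁻¹ * (ν' (f p.1) * p.2) = _
    rw [hf', ← mul_assoc]
    simp [preBd]
  have hact₀ : ∀ (v : F) (a : FreeGroup (Z × F)),
      Φ₀ (preAct Z v a) = N.act (OneObj.arr v) (Φ₀ a) := by
    intro v a
    refine DFunLike.congr_fun (f := Φ₀.comp (preAct Z v)) (g := (N.act (OneObj.arr v)).comp Φ₀)
      ?_ a
    ext p
    change Φ₀ (FreeGroup.of (p.1, p.2 * v)) = N.act (OneObj.arr v) (Φ₀ (FreeGroup.of p))
    rw [hΦ₀, hΦ₀]
    exact N.act_comp (OneObj.arr p.2) (OneObj.arr v) _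
  have hker : peiffer d ≤ Φ₀.ker := by
    refine Subgroup.normalClosure_le_normal ?_
    rintro _ ⟨a, b, rfl⟩
    change Φ₀ _ = 1
    have h₁ : OneObj.arr (preBd d b) = ν P (Φ₀ b) := (DFunLike.congr_fun hν₀ b).symm
    rw [map_mul, map_inv, hact₀, h₁, hν.peiffer, map_mul, map_mul, map_inv, inv_mul_cancel]
  let Φ : FreeGroup (Z × F) ⧸ peiffer d →* N.carrier P := QuotientGroup.lift _ Φ₀ hker
  refine ⟨fun _ => Φ, ⟨fun y z v c => ?_, fun y c => ?_, fun i => ?_⟩, ?_⟩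
  · obtain ⟨a, rfl⟩ := QuotientGroup.mk_surjective c
    exact hact₀ (OneObj.val v) a
  · obtain ⟨a, rfl⟩ := QuotientGroup.mk_surjective c
    exact DFunLike.congr_fun hν₀ a
  · exact (hΦ₀ (i, 1)).trans (N.act_id _ _)
  · rintro Ψ ⟨h₁, h₂, h₃⟩
    funext x
    refine QuotientGroup.monoidHom_ext (N := peiffer d) (G := FreeGroup (Z × F)) ?_
    ext p
    refine Eq.trans ?_ (hΦ₀ p).symm
    refine Eq.trans (congrArg (Ψ x) ?_) ((h₁ P x (OneObj.arr p.2) _).trans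
      (congrArg _ (h₃ p.1)))
    exact congrArg (fun w => (QuotientGroup.mk (FreeGroup.of (p.1, w)) :
      FreeGroup (Z × F) ⧸ peiffer d)) (one_mul p.2).symm

end FreeCrossedModule

/-! ### Existence of free extensions -/

section Attach

variable {O : Type u} [Groupoid.{u} O]

/-- The product of two families. -/
def OpFamily.prod (M N : OpFamily O) : OpFamily O where
  carrier x := M.carrier x × N.carrier x
  act v := (M.act v).prodMap (N.act v)
  act_id x c := Prod.ext (M.act_id x c.1) (N.act_id x c.2)
  act_comp v w c := Prod.ext (M.act_comp v w c.1) (N.act_comp v w c.2)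

/-- The elements of dimension `n + 2` of trivial boundary, as a family. -/
def CrossedComplex.kerFamily (C : CrossedComplex O) (n : ℕ) : OpFamily O where
  carrier x := C.bdKer n x
  act v :=
    { toFun := fun c => ⟨C.act n v c.1, C.act_mem_bdKer v c.2⟩
      map_one' := Subtype.ext (map_one (C.act n v))
      map_mul' := fun c d => Subtype.ext (map_mul (C.act n v) c.1 d.1) }
  act_id x c := Subtype.ext ((C.layer n).act_id x c.1)
  act_comp v w c := Subtype.ext ((C.layer n).act_comp v w c.1)

/-- Modules over the fundamental groupoid of `C`, one for each dimension from `3` on, with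
operator morphisms to the elements of trivial boundary one dimension lower. -/
structure Attachment (C : CrossedComplex O) where
  fam : ℕ → OpFamily O
  comm : ∀ n x (c d : (fam n).carrier x), c * d = d * c
  triv : ∀ n x (d : C.grp 0 x) (c : (fam n).carrier x), (fam n).act (C.bd₂ x d) c = c
  bd : ∀ n x, (fam n).carrier x →* C.bdKer n x
  bd_act : ∀ n {x y : O} (v : x ⟶ y) (c : (fam n).carrier x),
    (bd n y ((fam n).act v c)).1 = C.act n v (bd n x c).1

namespace Attachment

variable {C : CrossedComplex O} (T : Attachment C)

/-- The groups of the complex obtained by attaching the modules of `T`. -/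
def layer : ℕ → OpFamily O
  | 0 => C.layer 0
  | n + 1 => (C.layer (n + 1)).prod (T.fam n)

/-- The inclusion of the groups of `C`. -/
def incl : ∀ (n : ℕ) (x : O), C.grp n x →* (T.layer n).carrier x
  | 0, x => MonoidHom.id (C.grp 0 x)
  | n + 1, x => MonoidHom.inl (C.grp (n + 1) x) ((T.fam n).carrier x)

theorem incl_act : ∀ (n : ℕ) {x y : O} (v : x ⟶ y) (c : C.grp n x),
    T.incl n y (C.act n v c) = (T.layer n).act v (T.incl n x c)
  | 0, _, _, _, _ => rfl
  | n + 1, _, _, v, _ => Prod.ext rfl (map_one ((T.fam n).act v)).symm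

/-- The sum of the boundaries of `C` and of `T`, with values in `C`. -/
def total (n : ℕ) (x : O) : (T.layer (n + 1)).carrier x →* C.grp n x where
  toFun c := C.bd n x c.1 * (T.bd n x c.2).1
  map_one' := by
    change C.bd n x 1 * (T.bd n x 1).1 = 1
    rw [map_one, map_one, one_mul]
    rfl
  map_mul' c d := by
    change C.bd n x (c.1 * d.1) * (T.bd n x (c.2 * d.2)).1 =
      (C.bd n x c.1 * (T.bd n x c.2).1) * (C.bd n x d.1 * (T.bd n x d.2).1)
    rw [map_mul, map_mul]
    change _ * ((T.bd n x c.2).1 * (T.bd n x d.2).1) = _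
    rw [mul_assoc, mul_assoc, ← mul_assoc (C.bd n x d.1),
      ← C.bdKer_comm (T.bd n x c.2).2 (C.bd n x d.1), mul_assoc]

theorem total_mem_bdKer (n : ℕ) (x : O) (c : (T.layer (n + 1)).carrier x) :
    T.total n x c ∈ C.bdKer n x :=
  mul_mem (C.bd_mem_bdKer n x c.1) (T.bd n x c.2).2

theorem total_act (n : ℕ) {x y : O} (v : x ⟶ y) (c : (T.layer (n + 1)).carrier x) :
    T.total n y ((T.layer (n + 1)).act v c) = C.act n v (T.total n x c) := by
  change C.bd n y (C.act (n + 1) v c.1) * (T.bd n y ((T.fam n).act v c.2)).1 =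
    C.act n v (C.bd n x c.1 * (T.bd n x c.2).1)
  rw [C.bd_act, T.bd_act, map_mul]

/-- The crossed complex obtained from `C` by attaching the modules of `T`. -/
def complex : CrossedComplex O where
  layer := T.layer
  bd₂ := C.bd₂
  bd n x := (T.incl n x).comp (T.total n x)
  crossed := C.crossed
  comm n x c d := Prod.ext (C.comm n x c.1 d.1) (T.comm n x c.2 d.2)
  bd_act n x y v c := (congrArg _ (T.total_act n v c)).trans (T.incl_act n v _)
  bd₂_bd x c := T.total_mem_bdKer 0 x c
  bd_bd n x c := by
    change T.incl n x (C.bd n x (T.total (n + 1) x c) * (T.bd n x 1).1) = 1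
    rw [C.mem_bdKer_succ.1 (T.total_mem_bdKer (n + 1) x c), map_one, one_mul]
    exact map_one (T.incl n x)
  act_bd₂ n x d c := Prod.ext (C.act_bd₂ n x d c.1) (T.triv n x d c.2)

/-- The inclusion of `C`. -/
def inclHom : CrsHom (𝟭 O) C T.complex where
  map := T.incl
  map_act n _ _ v c := T.incl_act n v c
  map_bd₂ _ _ := rfl
  map_bd n x c := by
    change T.incl n x (C.bd n x c * (T.bd n x 1).1) = T.incl n x (C.bd n x c)
    rw [map_one]
    exact congrArg _ (mul_one _)

end Attachment

end Attach

section Existence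

variable {F G : Type u} [Group F] [Group G] {φ : F →* G} {C : CrossedComplex (OneObj F)}

/-- Attaching a free crossed module to a groupoid. -/
theorem exists_isFreeExtension_one (hC : C.IsTruncated 1) {Z : Type u} (d : Z → C.Elt 1) :
    ∃ (E : CrossedComplex (OneObj F)) (α : CrsHom (𝟭 (OneObj F)) C E) (z : Z → E.Elt 2),
      IsFreeExtension 1 C E α d z := by
  let d' : Z → F := fun i => OneObj.val (d i).2.2
  let E : CrossedComplex (OneObj F) :=
    { layer := fun n => match n with
        | 0 => freeCrossedModule d'
        | _ + 1 => constFamily (OneObj F) PUnit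
      bd₂ := freeCrossedModule.bd d'
      bd := fun _ _ => 1
      crossed := isCrossedModule_freeCrossedModule d'
      comm := fun _ _ _ _ => rfl
      bd_act := fun n _ _ v _ => (map_one _).symm
      bd₂_bd := fun x _ => (isCrossedModule_freeCrossedModule d').map_one x
      bd_bd := fun _ _ _ => rfl
      act_bd₂ := fun _ _ _ _ => rfl }
  have hsub (n : ℕ) (x : OneObj F) : Subsingleton (C.grp n x) := hC n x (by lia)
  let α : CrsHom (𝟭 (OneObj F)) C E :=
    { map := fun _ _ => 1
      map_act := fun n x y v c => (map_one (E.act n v)).symm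
      map_bd₂ := fun x c => by
        obtain rfl : c = 1 := (hsub 0 x).elim _ _
        exact (E.crossed.map_one x).trans (C.crossed.map_one x).symm
      map_bd := fun n x c => map_one (E.bd n x) }
  refine ⟨E, α, fun i => ⟨OneObj.pt F,
    (QuotientGroup.mk (FreeGroup.of (i, 1)) : FreeGroup (Z × F) ⧸ peiffer d')⟩,
    ⟨fun n x hn => ?_, fun n hn => by lia, ?_, fun i => ?_⟩⟩
  · obtain ⟨n, rfl⟩ : ∃ j, n = j + 1 := ⟨n - 1, by lia⟩
    exact (inferInstance : Subsingleton PUnit)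
  · exact isFreeCrossedModuleOn_freeCrossedModule d'
  · refine congrArg (fun v : F => (⟨OneObj.pt F, OneObj.pt F, OneObj.arr v⟩ :
      Σ a : OneObj F, Σ b : OneObj F, (a ⟶ b))) (?_ : _ = d' i)
    have h : preBd d' (FreeGroup.of (i, 1)) = d' i := by simp [preBd]
    exact h

/-- Attaching a free module, along generators of trivial boundary. -/
theorem exists_isFreeExtension_add_two {k : ℕ} (hC : C.IsTruncated (k + 2))
    (haug : Augments C (OneObj.functor φ)) (hφ : Function.Surjective φ)
    (hex : ∀ v : F, φ v = 1 → ∃ c, C.bd₂ (OneObj.pt F) c = OneObj.arr v)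
    {Z : Type u} (d : Z → C.Elt (k + 2)) (hd : ∀ i, (d i).2 ∈ C.bdKer k (d i).1) :
    ∃ (E : CrossedComplex (OneObj F)) (α : CrsHom (𝟭 (OneObj F)) C E) (z : Z → E.Elt (k + 3)),
      IsFreeExtension (k + 2) C E α d z := by
  -- The generators are put in one dimension only, all others having none.
  let Y : ℕ → Type u := fun n => {_i : Z // n = k}
  let d' : ∀ n, Y n → C.bdKer n (OneObj.pt F) := fun n i => by
    obtain ⟨i, rfl⟩ := i
    exact ⟨(d i).2, hd i⟩
  have hfree := fun n => isFreeModuleOn_freeModule (Y := Y n) hφ hex (Equiv.refl _)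
  choose bd' hbd' _ using fun n => hfree n (C.kerFamily n)
    (fun x c c' => mul_comm (G := C.bdKer n x) c c')
    (fun x e c => Subtype.ext (C.act_bd₂_bdKer e c.2)) (d' n)
  let T : Attachment C :=
    { fam := fun n => freeModule φ (Y n)
      comm := fun n => freeModule_comm φ
      triv := fun n x e c => freeModule_act_of_map_eq_one φ (haug x e) c
      bd := bd'
      bd_act := fun n x y v c => congrArg Subtype.val ((hbd' n).1 x y v c) }
  have hT : ∀ n, n ≠ k → ∀ x, Subsingleton ((T.fam n).carrier x) := fun n hn x => by
    have : IsEmpty (Y n) := ⟨fun i => hn i.2⟩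
    exact freeModule_subsingleton φ x
  refine ⟨T.complex, T.inclHom, fun i => ⟨OneObj.pt F,
    ((1, freeModule.basis φ (Y := Y k) ⟨i, rfl⟩ 1 _) :
      C.grp (k + 1) (OneObj.pt F) × (freeModule φ (Y k)).carrier (OneObj.pt F))⟩,
    ⟨fun n x hn => ?_, fun n hn x => ?_, ?_, fun i => ?_⟩⟩
  · obtain ⟨n, rfl⟩ : ∃ j, n = j + 1 := ⟨n - 1, by lia⟩
    have := hT n (by lia) x
    have := hC (n + 1) x (by lia)
    exact (inferInstance : Subsingleton (C.grp (n + 1) x × (T.fam n).carrier x))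
  · cases n with
    | zero => exact Function.bijective_id
    | succ n =>
      exact ⟨fun a b h => congrArg Prod.fst h, fun c => ⟨c.1, Prod.ext rfl
        ((hT n (by lia) x).elim _ _)⟩⟩
  · have hsub : ∀ x, Subsingleton (C.grp (k + 1) x) := fun x => hC (k + 1) x (by lia)
    exact (isFreeModuleOn_freeModule (Y := Y k) hφ hex
      (Z := Z) ⟨fun i => ⟨i, rfl⟩, fun i => i.1, fun _ => rfl, fun _ => rfl⟩).transfer
      (C' := T.complex) (M' := T.layer (k + 1))
      (fun x =>
        { toFun := fun t => ((1, t) : C.grp (k + 1) x × (T.fam k).carrier x)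
          invFun := fun t => t.2
          left_inv := fun _ => rfl
          right_inv := fun t => Prod.ext ((hsub x).elim _ _) rfl
          map_mul' := fun s t => Prod.ext (one_mul _).symm rfl })
      (fun v c => Prod.ext (map_one (C.act (k + 1) v)).symm rfl) (fun x e => ⟨e, rfl⟩)
  · have h₁ : T.total k (OneObj.pt F) ((1, freeModule.basis φ (Y := Y k) ⟨i, rfl⟩ 1 _) :
        C.grp (k + 1) (OneObj.pt F) × (freeModule φ (Y k)).carrier (OneObj.pt F)) =
        (d i).2 := by
      change C.bd k (OneObj.pt F) 1 * (bd' k (OneObj.pt F) _).1 = _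
      rw [map_one, one_mul]
      exact congrArg Subtype.val ((hbd' k).2 ⟨i, rfl⟩)
    exact congrArg (fun c => (⟨OneObj.pt F, T.incl k (OneObj.pt F) c⟩ :
      Σ x : OneObj F, (T.layer k).carrier x)) h₁

end Existence

/-! ### Free extensions of free crossed resolutions of a group -/

section Resolution

variable {F G : Type u} [Group F] [Group G] {φ : F →* G} {C E : CrossedComplex (OneObj F)}
  {m : ℕ} {α : CrsHom (𝟭 (OneObj F)) C E} {Z : Type u} {d : Z → C.Elt m} {z : Z → E.Elt (m + 1)}

/-- A free crossed resolution has a free extension with given boundaries of the generators, if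
these are right-hand sides of the homotopy relation of a partial contracting homotopy. -/
theorem IsFreeResolution.exists_isFreeExtension (hm : 1 ≤ m)
    (hC : IsFreeResolution m C (OneObj.functor φ))
    {h : Contraction (cover C φ hC.augments) (CovObj.base φ)} (hh : h.IsContracting m)
    (hd : ∀ i, ∃ c, d i = (cover.proj C φ hC.augments).elt m (h.loop m c)) :
    ∃ (E : CrossedComplex (OneObj F)) (α : CrsHom (𝟭 (OneObj F)) C E) (z : Z → E.Elt (m + 1)),
      IsFreeExtension m C E α d z := by
  match m, hm with
  | 1, _ => exact exists_isFreeExtension_one hC.truncated d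
  | k + 2, _ =>
    refine exists_isFreeExtension_add_two hC.truncated hC.augments hC.surjective
      (fun v hv => hC.exact₁ (by lia) (OneObj.pt F) (OneObj.arr v) hv) d (fun i => ?_)
    obtain ⟨c, hc⟩ := hd i
    rw [hc, h.loop_eq_loopFun]
    have hmem := hh.loopFun_mem_bdKer le_rfl c.1 c.2
    cases k with
    | zero => exact congrArg Subtype.val hmem
    | succ k => exact hmem

/-- The kernel of `φ`, as a crossed module. -/
def kernelFamily (φ : F →* G) : OpFamily (OneObj F) where
  carrier _ := φ.ker
  act v := (MulAut.conjNormal (OneObj.val v)⁻¹).toMonoidHom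
  act_id x c := Subtype.ext (by
    change ((1 : F)⁻¹ * c.1 * (1 : F)⁻¹⁻¹) = c.1
    simp)
  act_comp v w c := Subtype.ext (by
    change (OneObj.val v * OneObj.val w)⁻¹ * c.1 * (OneObj.val v * OneObj.val w)⁻¹⁻¹ =
      (OneObj.val w)⁻¹ * ((OneObj.val v)⁻¹ * c.1 * (OneObj.val v)⁻¹⁻¹) * (OneObj.val w)⁻¹⁻¹
    group)

theorem isCrossedModule_kernelFamily (φ : F →* G) :
    IsCrossedModule (kernelFamily φ) (fun _ c => OneObj.arr c.1) where
  map_mul _ _ _ := rfl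
  map_act v c := by
    change (OneObj.val v)⁻¹ * c.1 * (OneObj.val v)⁻¹⁻¹ = (OneObj.val v)⁻¹ * (c.1 * OneObj.val v)
    rw [inv_inv, mul_assoc]
  peiffer _ c e := Subtype.ext (by
    change e.1⁻¹ * c.1 * e.1⁻¹⁻¹ = e.1⁻¹ * c.1 * e.1
    rw [inv_inv])

/-- In dimension 2 the new generators have boundaries in the kernel of `φ`, hence all elements
have, by the universal property applied to the crossed module `kernelFamily φ`. -/
theorem IsFreeExtension.augments (hm : 1 ≤ m) (hC : Augments C (OneObj.functor φ))
    {h : Contraction (cover C φ hC) (CovObj.base φ)}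
    (hd : ∀ i, ∃ c, d i = (cover.proj C φ hC).elt m (h.loop m c))
    (hE : IsFreeExtension m C E α d z) : Augments E (OneObj.functor φ) := by
  match m, hm with
  | 1, _ =>
    have hbd : ∀ i, φ (OneObj.val (E.bd₂ (z i).1 (z i).2)) = 1 := by
      intro i
      have h₁ : (⟨_, _, E.bd₂ (z i).1 (z i).2⟩ : Σ a : OneObj F, Σ b : OneObj F, (a ⟶ b)) =
        d i := hE.bd i
      obtain ⟨⟨a, b, v⟩, hc⟩ := hd i
      rw [hc] at h₁
      let w : CovObj.base φ ⟶ CovObj.base φ := Groupoid.inv (h.h₀ a) ≫ v ≫ h.h₀ b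
      have h₂ : OneObj.val (E.bd₂ (z i).1 (z i).2) = w.1 :=
        congrArg (fun p : Σ a : OneObj F, Σ b : OneObj F, (a ⟶ b) => OneObj.val p.2.2) h₁
      rw [h₂]
      exact mul_left_cancel (w.2.trans (mul_one _).symm)
    obtain ⟨Φ, ⟨_, h₂, _⟩, _⟩ := hE.free (kernelFamily φ) _ (isCrossedModule_kernelFamily φ)
      (fun i => ⟨OneObj.val (E.bd₂ (z i).1 (z i).2), hbd i⟩) (fun i => rfl)
    intro x c
    have h₃ : φ (OneObj.val (E.bd₂ x c)) = 1 := by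
      rw [← h₂ x c]
      exact (Φ x c).2
    exact h₃
  | k + 2, _ =>
    intro x c
    obtain ⟨c, rfl⟩ := (hE.bijective 0 (by lia) x).2 c
    exact (congrArg (OneObj.functor φ).map (α.map_bd₂ x c)).trans (hC x c)

/-- A contracting homotopy of the universal cover yields exactness. -/
theorem IsFreeExtension.isFreeResolution (hC : IsFreeResolution m C (OneObj.functor φ))
    (hE : IsFreeExtension m C E α d z) (haug : Augments E (OneObj.functor φ))
    {k : Contraction (cover E φ haug) (CovObj.base φ)} (hk : k.IsContracting (m + 1)) :
    IsFreeResolution (m + 1) E (OneObj.functor φ) where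
  truncated := hE.truncated
  free n h₁ h₂ := by
    rcases h₂.lt_or_eq with hn | rfl
    · obtain ⟨X, b, hb⟩ := hC.free n h₁ (by lia)
      exact ⟨X, _, hb.transfer hE.bijective (by lia)⟩
    · exact ⟨Z, z, hE.free⟩
  obj_bijective := hC.obj_bijective
  map_surjective := hC.map_surjective
  augments := haug
  exact₁ hm x v hv := by
    obtain ⟨c, hc⟩ := hk.exists_bd₂_eq (by lia) (CovObj.base φ)
      ⟨OneObj.val v, (congrArg _ (show φ (OneObj.val v) = 1 from hv)).trans (mul_one _)⟩
    exact ⟨c, congrArg Subtype.val hc⟩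
  exact₂ hm x c hc :=
    hk.exists_bd_eq (n := 0) (by lia) (x := CovObj.base φ) (c := c) (Subtype.ext hc)
  exact n hn x c hc :=
    hk.exists_bd_eq (n := n + 1) (by lia) (x := CovObj.base φ) (c := c) hc

theorem cover_bdElt_lift (hm : 1 ≤ m) {hC : Augments C (OneObj.functor φ)}
    {haug : Augments E (OneObj.functor φ)} {h : Contraction (cover C φ hC) (CovObj.base φ)}
    {x : E.Elt (m + 1)} {c : (cover C φ hC).Elt m}
    (hx : E.bdElt m x = α.elt m ((cover.proj C φ hC).elt m (h.loop m c))) :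
    (cover E φ haug).bdElt m (cover.lift E φ haug 1 (m + 1) x) =
      (cover.map α φ hC haug).elt m (h.loop m c) := by
  match m, hm with
  | 1, _ =>
    obtain ⟨a, b, v⟩ := c
    obtain ⟨y, x⟩ := x
    let w : CovObj.base φ ⟶ CovObj.base φ := Groupoid.inv (h.h₀ a) ≫ v ≫ h.h₀ b
    have h₁ : OneObj.val (E.bd₂ y x) = w.1 :=
      congrArg (fun p : Σ a : OneObj F, Σ b : OneObj F, (a ⟶ b) => OneObj.val p.2.2) hx
    have h₂ : (cover E φ haug).bd₂ (CovObj.base φ) x = w := Subtype.ext h₁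
    exact congrArg (fun w => (⟨CovObj.base φ, CovObj.base φ, w⟩ :
      Σ a : CovObj φ, Σ b : CovObj φ, (a ⟶ b))) h₂
  | n + 2, _ =>
    rw [h.loop_eq_loopFun] at hx ⊢
    obtain ⟨y, x⟩ := x
    have h₁ : E.bd n y x = α.map n (OneObj.pt F) (h.loopFun n c.1 c.2) :=
      eq_of_heq (Sigma.mk.inj hx).2
    exact congrArg (fun e => (⟨CovObj.base φ, e⟩ : Σ _ : CovObj φ, E.grp n (OneObj.pt F))) h₁

theorem cover_map_elt_map_elt {E' : CrossedComplex (OneObj F)} {α' : CrsHom (𝟭 (OneObj F)) C E'}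
    {ξ : CrsHom (𝟭 (OneObj F)) E E'} {hC : Augments C (OneObj.functor φ)}
    {hE : Augments E (OneObj.functor φ)} {hE' : Augments E' (OneObj.functor φ)}
    (hξ : ∀ c : C.Elt m, ξ.elt m (α.elt m c) = α'.elt m c) (c : (cover C φ hC).Elt m) :
    (cover.map ξ φ hE hE').elt m ((cover.map α φ hC hE).elt m c) =
      (cover.map α' φ hC hE').elt m c := by
  match m with
  | 0 => rfl
  | 1 => rfl
  | n + 2 =>
    obtain ⟨g, c⟩ := c
    have h₁ : ξ.map n (OneObj.pt F) (α.map n (OneObj.pt F) c) = α'.map n (OneObj.pt F) c :=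
      eq_of_heq (Sigma.mk.inj (hξ ⟨OneObj.pt F, c⟩)).2
    exact congrArg (fun e => (⟨g, e⟩ : Σ _ : CovObj φ, E'.grp n (OneObj.pt F))) h₁

end Resolution

end FreeCrossed

theorem mainTheorem3 {F G : Type u} [Group F] [Group G] (m : ℕ) (hm : 1 ≤ m)
    (C : CrossedComplex (OneObj F)) (φ : F →* G)
    (hC : IsFreeResolution m C (OneObj.functor φ))
    (h : Contraction (cover C φ hC.augments) (CovObj.base φ)) (hh : h.IsContracting m)
    -- the basis of the cover in dimension `m`, and its copy
    (Xt : Type u) (xt : Xt → (cover C φ hC.augments).Elt m)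
    (hxt : (cover C φ hC.augments).IsFreeOn m xt)
    (X : Type u) (e : Xt ≃ X)
    -- the boundaries of the new generators
    (d : X → C.Elt m)
    (hd : ∀ i : Xt, d (e i) = (cover.proj C φ hC.augments).elt m (h.loop m (xt i))) :
    -- the universal cover is a free crossed resolution of the universal covering groupoid,
    -- free on the inverse images of the bases of `C`
    ((cover.proj C φ hC.augments).IsCovering ∧
      IsFreeResolution m (cover C φ hC.augments) (CovObj.toUniv φ) ∧
      ∀ (n : ℕ) (Z : Type u) (z : Z → C.Elt n), 1 ≤ n → n ≤ m → C.IsFreeOn n z →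
        (cover C φ hC.augments).IsFreeOn n
          (fun i : G × Z => cover.lift C φ hC.augments i.1 n (z i.2))) ∧
    -- the extension exists
    (∃ (E : CrossedComplex (OneObj F)) (α : CrsHom (𝟭 (OneObj F)) C E)
        (x : X → E.Elt (m + 1)), IsFreeExtension m C E α d x) ∧
    ∀ (E : CrossedComplex (OneObj F)) (α : CrsHom (𝟭 (OneObj F)) C E)
      (x : X → E.Elt (m + 1)), IsFreeExtension m C E α d x →
      -- it is a free crossed resolution of `G`
      IsFreeResolution (m + 1) E (OneObj.functor φ) ∧
      ∃ hE : Augments E (OneObj.functor φ),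
        -- its universal cover extends that of `C`
        (cover.proj E φ hE).IsCovering ∧
        (∀ (n : ℕ) (c : (cover C φ hC.augments).Elt n),
          (cover.proj E φ hE).elt n ((cover.map α φ hC.augments hE).elt n c) =
            α.elt n ((cover.proj C φ hC.augments).elt n c)) ∧
        -- and has a unique contracting homotopy `k` extending `h` with `k_m (x̃) = (1, x)`
        ∃ k : Contraction (cover E φ hE) (CovObj.base φ),
          (k.IsContracting (m + 1) ∧ k.Extends m h (cover.map α φ hC.augments hE) ∧
            ∀ i : Xt, k.elt m ((cover.map α φ hC.augments hE).elt m (xt i)) =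
              cover.lift E φ hE 1 (m + 1) (x (e i))) ∧
          (∀ k' : Contraction (cover E φ hE) (CovObj.base φ),
            k'.IsContracting (m + 1) → k'.Extends m h (cover.map α φ hC.augments hE) →
            (∀ i : Xt, k'.elt m ((cover.map α φ hC.augments hE).elt m (xt i)) =
              cover.lift E φ hE 1 (m + 1) (x (e i))) → k' = k) ∧
          -- reduction to a subset `Y` of the new generators
          ∀ Y : Set X, GeneratesKernel C φ m (d '' Y) →
            (∃ (E' : CrossedComplex (OneObj F)) (α' : CrsHom (𝟭 (OneObj F)) C E')
              (y : Y → E'.Elt (m + 1)), IsFreeExtension m C E' α' (fun i : Y => d i) y) ∧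
            ∀ (E' : CrossedComplex (OneObj F)) (α' : CrsHom (𝟭 (OneObj F)) C E')
              (y : Y → E'.Elt (m + 1)), IsFreeExtension m C E' α' (fun i : Y => d i) y →
              -- the retraction, as a morphism that is the identity in dimensions up to `m`
              ∀ ξ : CrsHom (𝟭 (OneObj F)) E E',
                (∀ n : ℕ, n ≤ m → ∀ c : C.Elt n, ξ.elt n (α.elt n c) = α'.elt n c) →
                (∀ i : Y, ξ.elt (m + 1) (x i) = y i) →
                IsFreeResolution (m + 1) E' (OneObj.functor φ) ∧
                ∃ hE' : Augments E' (OneObj.functor φ),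
                  (cover.proj E' φ hE').IsCovering ∧
                  ∃! k' : Contraction (cover E' φ hE') (CovObj.base φ),
                    k'.IsContracting (m + 1) ∧
                    k'.Extends m h (cover.map α' φ hC.augments hE') ∧
                    ∀ c : (cover C φ hC.augments).Elt m,
                      k'.elt m ((cover.map α' φ hC.augments hE').elt m c) =
                        (cover.map ξ φ hE hE').elt (m + 1)
                          (k.elt m ((cover.map α φ hC.augments hE).elt m c)) := by 
  have hd' : ∀ i, ∃ c, d i = (cover.proj C φ hC.augments).elt m (h.loop m c) := fun i => by
    obtain ⟨i, rfl⟩ := e.surjective i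
    exact ⟨_, hd i⟩
  refine ⟨⟨isCovering_cover_proj, isFreeResolution_cover hC, fun n Z z _ _ hz =>
    isFreeOn_cover hz⟩, hC.exists_isFreeExtension hm hh hd', fun E α x hE => ?_⟩
  have haug := hE.augments hm hC.augments hd'
  have hbij : ∀ n : ℕ, n + 2 ≤ m → ∀ g,
      Function.Bijective ((cover.map α φ hC.augments haug).map n g) :=
    fun n hn _ => hE.bijective n hn (OneObj.pt F)
  have hbd : ∀ i, (cover E φ haug).bdElt m (cover.lift E φ haug 1 (m + 1) (x (e i))) =
      (cover.map α φ hC.augments haug).elt m (h.loop m (xt i)) := fun i =>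
    cover_bdElt_lift hm ((hE.bd (e i)).trans (congrArg _ (hd i)))
  obtain ⟨k, ⟨hk, hkh, hkx⟩, hkuniq⟩ := Contraction.existsUnique_extension_along hbij hm hh
    (fun n _ hn => hE.truncated n (OneObj.pt F) hn) hxt _ hbd
  refine ⟨hE.isFreeResolution hC haug hk, haug, isCovering_cover_proj, fun n c => ?_, k,
    ⟨hk, hkh, hkx⟩, fun k' h₁ h₂ h₃ => hkuniq k' ⟨h₁, h₂, h₃⟩, fun Y _ => ?_⟩
  · match n with
    | 0 => rfl
    | 1 => rfl
    | n + 2 => rfl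
  refine ⟨hC.exists_isFreeExtension hm hh fun i => hd' i, fun E' α' y hE' ξ hξ _ => ?_⟩
  have haug' := IsFreeExtension.augments (d := fun i : Y => d i) hm hC.augments
    (fun i => hd' i) hE'
  have hbij' : ∀ n : ℕ, n + 2 ≤ m → ∀ g,
      Function.Bijective ((cover.map α' φ hC.augments haug').map n g) :=
    fun n hn _ => hE'.bijective n hn (OneObj.pt F)
  -- The values `ξ̃ h_m` on generators satisfy the homotopy relation, as `ξ` respects boundaries.
  obtain ⟨k', ⟨hk', hkh', hkx'⟩, hkuniq'⟩ := Contraction.existsUnique_extension_along hbij' hm hh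
    (fun n _ hn => hE'.truncated n (OneObj.pt F) hn) hxt
    (fun i => (cover.map ξ φ haug haug').elt (m + 1) (cover.lift E φ haug 1 (m + 1) (x (e i))))
    (fun i => by
      rw [CrsHom.elt_bdElt _ hm, hbd]
      exact cover_map_elt_map_elt (hξ m le_rfl) _)
  refine ⟨hE'.isFreeResolution hC haug' hk', haug', isCovering_cover_proj, k',
    ⟨hk', hkh', Contraction.elt_eq_of_generators hm hk hk' _ hxt fun i => ?_⟩,
    fun k'' ⟨h₁, h₂, h₃⟩ => hkuniq' k'' ⟨h₁, h₂, fun i => ?_⟩⟩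
  · rw [hkx', hkx]
  · rw [h₃, hkx]
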